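/- **Conventions.** A function $f:\mathbb R^2\to\mathbb R$ is a *test function* if it is Borel measurable, bounded, and vanishes outside a bounded set; $\hat f(u)=\int_{\mathbb R^2} e^{-i\langle u,t\rangle}f(t)\,dt$. A *(wide-sense) stationary random measure* $\mathsf M$ on $\mathbb R^2$ is a family of square-integrable real random variables $I_{\mathsf M}(f)$, on a probability space and indexed by the test functions, such that: - $I_{\mathsf M}(af+bg)=aI_{\mathsf M}(f)+bI_{\mathsf M}(g)$ a.s. for all $a,b\in\mathbb R$ and test functions $f,g$; - $\sum_n I_{\mathsf M}(f_n)=I_{\mathsf M}(g)$ a.s. whenever $f_n\ge 0$ and $g$ are test functions with $\sum_n f_n=g$ pointwise; - $\operatorname{Var}(I_{\mathsf M}(f(\cdot-x)))=\operatorname{Var}(I_{\mathsf M}(f))$ for every test function $f$ and every $x\in\mathbb R^2$. Its *spectral measure* is an even nonnegative Borel measure $\mathsf S$ with $\operatorname{Var}(I_{\mathsf M}(f))=\int|\hat f|^2\,d\mathsf S$ for all test functions $f$; its *spectral density* $s\ge 0$ is (a version of) the density of the absolutely continuous part of $\mathsf S$. It has *mean intensity* $\lambda$ if $\mathbf E\,I_{\mathsf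 M}(f)=\lambda\int f(x)\,dx$ for all test functions $f$. Write $\mathsf M(A)=I_{\mathsf M}(1_A)$. For a set $A$ and a test function $\gamma$, $\mathsf M$ is *linearly $\gamma$-rigid on $A$* if $\inf_h\operatorname{Var}(I_{\mathsf M}(\gamma)-I_{\mathsf M}(h))=0$, the infimum being over the test functions $h$ that vanish on $A$; it is *linearly maximally rigid on $A$* if this holds for every test function $\gamma$. **Proposition.** 1. Let $\mathsf M$ be a stationary random measure on $\mathbb R^2$ with spectral density $s$ such that $s(u)=u_2^2$ for all $u=(u_1,u_2)$ in some neighbourhood of $(1,0)$. Then $\mathsf M$ is mass rigid on every bounded Borel set $A\subset\mathbb R^2$. That is, $\mathsf M(A)$ is a.s. equal to a random variable that is measurable with respect to the $\sigma$-algebra generated by the variables $I_{\mathsf M}(h)$, $h$ a test function vanishing on $A$. Moreover the rigidity is linear: $\mathsf M$ is linearly $1_A$-rigid on $A$, and if $\mathsf M$ has some mean intensity $\lambda\in\mathbb R$, then there are test functions $h_n$ vanishing on $A$ such that $I_{\mathsf M}(h_n)\to\mathsf M(A)$ almost surely and in $L^2$. 2. Such an $s$ need not vanish near $0$, and $\mathsf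 M$ need not be maximally rigid: there is a stationary random measure $\mathsf M$ on $\mathbb R^2$ with mean intensity $1$ whose spectral density satisfies $s(u)=u_2^2$ in a neighbourhood of $(1,0)$ and $s(u)=1$ in a neighbourhood of $0$, and which is not linearly maximally rigid on any bounded Borel set with nonempty interior. (So the structural assumptions on $s$ cannot be dropped in converse results that deduce the non-integrability of $s^{-1}$ at $0$ from mass rigidity and the absence of maximal rigidity.) -/

import Mathlib

open MeasureTheory ProbabilityTheory Filter Topology

noncomputable section

namespace SpectralRigidity

/-- The space `ℝ^d` with its Euclidean structure. -/
abbrev E (d : ℕ) : Type := EuclideanSpace ℝ (Fin d)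

/-- The test functions: real, Borel measurable, bounded and with bounded support. -/
def IsTest {d : ℕ} (f : E d → ℝ) : Prop :=
  Measurable f ∧ (∃ C : ℝ, ∀ x, |f x| ≤ C) ∧ Bornology.IsBounded (Function.support f)

/-- The test functions that vanish outside of `B`. -/
def IsTestOn {d : ℕ} (B : Set (E d)) (f : E d → ℝ) : Prop :=
  IsTest f ∧ Function.support f ⊆ B

/-- A wide-sense stationary `L²` random signed measure on `ℝ^d`: square integrable real random
variables `I f`, indexed by the test functions `f`, that depend almost surely linearly and
countably additively on `f`, and whose variances are invariant under translations of `f`.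
(The values of `I` at functions that are not test functions play no role.) -/
structure StationaryRandomMeasure (d : ℕ) {Ω : Type*} [MeasurableSpace Ω] (P : Measure Ω) where
  /-- The linear statistic `I f = ∫ f dM`. -/
  I : (E d → ℝ) → Ω → ℝ
  memLp : ∀ f, IsTest f → MemLp (I f) 2 P
  linear : ∀ (a b : ℝ) (f g : E d → ℝ), IsTest f → IsTest g →
    ∀ᵐ ω ∂P, I (fun x => a * f x + b * g x) ω = a * I f ω + b * I g ω
  sigmaAdditive : ∀ (f : ℕ → E d → ℝ) (g : E d → ℝ), (∀ n, IsTest (f n)) → IsTest g →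
    (∀ n x, 0 ≤ f n x) → (∀ x, HasSum (fun n => f n x) (g x)) →
    ∀ᵐ ω ∂P, Tendsto (fun N => ∑ n ∈ Finset.range N, I (f n) ω) atTop (𝓝 (I g ω))
  variance_translate : ∀ (f : E d → ℝ) (x : E d), IsTest f →
    Var[I (fun y => f (y - x)); P] = Var[I f; P]

/-- The Fourier transform `u ↦ ∫ e^{-i ⟨u, t⟩} f(t) dt`. -/
def fourierHat {d : ℕ} (f : E d → ℝ) (u : E d) : ℂ :=
  ∫ t, Complex.exp (-(Complex.I * ((inner ℝ u t : ℝ) : ℂ))) * (f t : ℂ)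

/-- `s` is a version of the density of the absolutely continuous part of the measure `S`
(the other part of `S` being singular to Lebesgue measure). -/
def IsSpectralDensity {d : ℕ} (S : Measure (E d)) (s : E d → ℝ) : Prop :=
  Measurable s ∧ (∀ u, 0 ≤ s u) ∧
    ∃ ν : Measure (E d), ν ⟂ₘ volume ∧
      S = volume.withDensity (fun u => ENNReal.ofReal (s u)) + ν

namespace StationaryRandomMeasure

variable {d : ℕ} {Ω : Type*} [MeasurableSpace Ω] {P : Measure Ω}

/-- `M` has mean intensity `l`: the expectation of `∫ f dM` is `l ∫ f(x) dx`. -/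
def HasMeanIntensity (M : StationaryRandomMeasure d P) (l : ℝ) : Prop :=
  ∀ f, IsTest f → ∫ ω, M.I f ω ∂P = l * ∫ x, f x

/-- `S` is the spectral measure of `M`: the nonnegative even measure with
`Var (I f) = ∫ |f̂|² dS` for all test functions `f`. -/
def IsSpectralMeasure (M : StationaryRandomMeasure d P) (S : Measure (E d)) : Prop :=
  S.map (fun u => -u) = S ∧
    ∀ f, IsTest f → ∫⁻ u, ‖fourierHat f u‖ₑ ^ 2 ∂S = ENNReal.ofReal (Var[M.I f; P])

/-- The σ-algebra generated by `M` outside of `A`, that is, by the variables `I h` for the test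
functions `h` that vanish on `A`. -/
@[reducible] def outside (M : StationaryRandomMeasure d P) (A : Set (E d)) : MeasurableSpace Ω :=
  ⨆ (h : E d → ℝ) (_ : IsTestOn Aᶜ h), MeasurableSpace.comap (M.I h) (borel ℝ)

/-- Mass rigidity: up to a null event, `M(A)` is a measurable functional of `M` outside of `A`. -/
def MassRigid (M : StationaryRandomMeasure d P) (A : Set (E d)) : Prop :=
  ∃ g : Ω → ℝ, Measurable[M.outside A] g ∧ ∀ᵐ ω ∂P, M.I (A.indicator fun _ => 1) ω = g ω

/-- Linear rigidity of `γ` on `A`: the infimum of `Var (I γ - I h)` over the test functions `h`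
that vanish on `A` is zero. -/
def LinearlyRigid (M : StationaryRandomMeasure d P) (A : Set (E d)) (γ : E d → ℝ) : Prop :=
  ∀ ε > 0, ∃ h, IsTestOn Aᶜ h ∧ Var[fun ω => M.I γ ω - M.I h ω; P] < ε

/-- `I γ` is the limit, almost surely and in `L²`, of a sequence of variables `I (h n)` where the
test functions `h n` vanish on `A`. -/
def IsLinearLimit (M : StationaryRandomMeasure d P) (A : Set (E d)) (γ : E d → ℝ) : Prop :=
  ∃ h : ℕ → E d → ℝ, (∀ n, IsTestOn Aᶜ (h n)) ∧
    (∀ᵐ ω ∂P, Tendsto (fun n => M.I (h n) ω) atTop (𝓝 (M.I γ ω))) ∧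
    Tendsto (fun n => eLpNorm (fun ω => M.I γ ω - M.I (h n) ω) 2 P) atTop (𝓝 0)

/-- Linear maximal rigidity on `A`: linear rigidity of every test function. -/
def LinearlyMaximallyRigid (M : StationaryRandomMeasure d P) (A : Set (E d)) : Prop :=
  ∀ γ, IsTest γ → M.LinearlyRigid A γ

end StationaryRandomMeasure

end SpectralRigidity

end

/-! For the first statement, work in `L²(S)`. Since a closed subspace equals its double orthogonal
complement (`HatFinite.exists_eLpNorm_lt`), approximating `1_A` by test functions vanishing on `A`
amounts to this: every `φ` in `L²(S)` orthogonal to all `ĥ`, with `h` vanishing on `A`, is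
orthogonal to the transform of `1_A`. For such a `φ`, the pairing `f ↦ ∫ φ̄ f̂ dS` depends only on
`f` restricted to `A`. By the closed graph theorem (`continuous_hatLp`) it is a continuous
functional `T` on `C(K)`, for a closed ball `K` containing `A`.

Hence the Fourier transform of the measure `φ̄ dS` lives on a compact set, as in Paley–Wiener: `φ̄
dS` has the density `ψ(u) = (2π)^{-d} T(e^{i⟨u,·⟩})`, which is analytic along lines. The singular
part of `S` contributes nothing and `φ̄ s = ψ` almost everywhere (`PairingVanishes.density_eq`). As
`|φ|² s` is integrable and `s = u₂²` near `(1,0)`, the continuous function `ψ` must vanish on the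
zero line `u₂ = 0` near `(1,0)` (`eq_zero_of_density`). By analyticity it vanishes on that whole
line, in particular at the origin, where it is a multiple of `T(1)`, the pairing of `φ` with `1_A`
(`PairingVanishes.pairing_indicator_eq_zero`). Running the argument for `S + δ₀` in place of `S`
controls the means as well, whence the limit in `L²`.

For the second statement, any nonzero finite even measure is the spectral measure of a wave with
random frequency and random sign (`randomWave`). The example has a density `s` with `u₂² ≤ s(u)
(1+|u|²)³`. For a bump `b` supported in `A`, the transform of `γ = ∂₂b` carries a factor `u₂`, so by
Cauchy–Schwarz `(∫ f γ)²` is at most a constant times the variance of the statistic of `f`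
(`sq_integral_le`). For `f = γ - h` with `h` vanishing on `A`, the left side is `(∫ γ²)²`, so the
variance stays away from zero. -/

noncomputable section
namespace SpectralRigidity
open scoped FourierTransform ENNReal NNReal ContDiff ComplexConjugate

/-! ### Fourier transforms of test functions -/

/-- The Fourier transform `u ↦ ∫ e^{-i ⟨u, t⟩} f(t) dt` of a complex function. -/
def hat {d : ℕ} (f : E d → ℂ) (u : E d) : ℂ :=
  ∫ t, Complex.exp (-(Complex.I * ((inner ℝ u t : ℝ) : ℂ))) * f t

/-- Complex test functions. -/
structure IsTestC {d : ℕ} (f : E d → ℂ) : Prop where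
  measurable : Measurable f
  bounded : ∃ C : ℝ, ∀ x, ‖f x‖ ≤ C
  support : Bornology.IsBounded (Function.support f)

section Hat

variable {d : ℕ} {f g : E d → ℂ}

lemma hat_eq_fourier (f : E d → ℂ) (u : E d) : hat f u = 𝓕 f ((2 * Real.pi)⁻¹ • u) := by
  rw [Real.fourier_eq']
  unfold hat
  refine integral_congr_ae (.of_forall fun t => ?_)
  simp only [smul_eq_mul]
  congr 2
  rw [inner_smul_right, real_inner_comm]
  have := Real.pi_ne_zero
  push_cast
  have h2 : (Real.pi : ℂ) ≠ 0 := by exact_mod_cast this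
  field_simp

lemma fourier_eq_hat (f : E d → ℂ) (w : E d) : 𝓕 f w = hat f ((2 * Real.pi) • w) := by
  have := Real.pi_pos
  rw [hat_eq_fourier, smul_smul, inv_mul_cancel₀ (by positivity), one_smul]

lemma IsTestC.integrable (hf : IsTestC f) : Integrable f := by
  obtain ⟨C, hC⟩ := hf.bounded
  obtain ⟨R, hR⟩ := hf.support.subset_closedBall 0
  have : IntegrableOn f (Metric.closedBall 0 R) :=
    Measure.integrableOn_of_bounded (measure_closedBall_lt_top).ne
      hf.measurable.aestronglyMeasurable (M := C) (.of_forall hC)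
  exact (integrableOn_iff_integrable_of_support_subset hR).1 this

lemma IsTestC.add (hf : IsTestC f) (hg : IsTestC g) : IsTestC (fun x => f x + g x) := by
  obtain ⟨C, hC⟩ := hf.bounded
  obtain ⟨D, hD⟩ := hg.bounded
  refine ⟨hf.measurable.add hg.measurable, ⟨C + D, fun x => (norm_add_le _ _).trans
    (add_le_add (hC x) (hD x))⟩, (hf.support.union hg.support).subset ?_⟩
  intro x hx
  by_contra h
  simp only [Set.mem_union, Function.mem_support, not_or, not_not] at h
  simp [h.1, h.2] at hx

lemma IsTestC.smul (hf : IsTestC f) (c : ℂ) : IsTestC (fun x => c * f x) := by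
  obtain ⟨C, hC⟩ := hf.bounded
  refine ⟨hf.measurable.const_mul c, ⟨‖c‖ * C, fun x => ?_⟩, hf.support.subset ?_⟩
  · rw [norm_mul]; exact mul_le_mul_of_nonneg_left (hC x) (norm_nonneg _)
  · intro x hx hfx
    simp [hfx] at hx

lemma IsTestC.sub (hf : IsTestC f) (hg : IsTestC g) : IsTestC (fun x => f x - g x) := by
  have := hf.add (hg.smul (-1))
  simpa [sub_eq_add_neg] using this

lemma IsTest.ofReal {f : E d → ℝ} (hf : IsTest f) : IsTestC (fun x => (f x : ℂ)) := by
  obtain ⟨h1, ⟨C, hC⟩, h3⟩ := hf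
  refine ⟨Complex.measurable_ofReal.comp h1, ⟨C, fun x => by simpa using hC x⟩, h3.subset ?_⟩
  intro x hx
  simpa using hx

lemma IsTestC.re (hf : IsTestC f) : IsTest (fun x => (f x).re) := by
  obtain ⟨C, hC⟩ := hf.bounded
  refine ⟨Complex.measurable_re.comp hf.measurable,
    ⟨C, fun x => (Complex.abs_re_le_norm _).trans (hC x)⟩, hf.support.subset ?_⟩
  intro x hx hfx
  simp [hfx] at hx

lemma IsTestC.im (hf : IsTestC f) : IsTest (fun x => (f x).im) := by
  obtain ⟨C, hC⟩ := hf.bounded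
  refine ⟨Complex.measurable_im.comp hf.measurable,
    ⟨C, fun x => (Complex.abs_im_le_norm _).trans (hC x)⟩, hf.support.subset ?_⟩
  intro x hx hfx
  simp [hfx] at hx

lemma IsTest.linearComb {f g : E d → ℝ} (hf : IsTest f) (hg : IsTest g) (a b : ℝ) :
    IsTest (fun x => a * f x + b * g x) := by
  have := ((hf.ofReal.smul a).add (hg.ofReal.smul b)).re
  simpa using this

lemma IsTest.sub {f g : E d → ℝ} (hf : IsTest f) (hg : IsTest g) :
    IsTest (fun x => f x - g x) := by
  simpa [sub_eq_add_neg] using hf.linearComb hg 1 (-1)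

lemma IsTest.integrable {f : E d → ℝ} (hf : IsTest f) : Integrable f := by
  simpa using hf.ofReal.integrable.re

lemma isTest_indicator_one {A : Set (E d)} (hA : MeasurableSet A) (hb : Bornology.IsBounded A) :
    IsTest (A.indicator fun _ => (1 : ℝ)) := by
  refine ⟨measurable_const.indicator hA, ⟨1, fun x => ?_⟩, hb.subset (by simp)⟩
  by_cases h : x ∈ A <;> simp [h]

lemma norm_exp_neg_I_mul (r : ℝ) : ‖Complex.exp (-(Complex.I * (r : ℂ)))‖ = 1 := by
  rw [show -(Complex.I * (r : ℂ)) = ((-r : ℝ) : ℂ) * Complex.I by push_cast; ring,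
    Complex.norm_exp_ofReal_mul_I]

lemma integrable_exp_mul (hf : Integrable f) (u : E d) :
    Integrable (fun t => Complex.exp (-(Complex.I * ((inner ℝ u t : ℝ) : ℂ))) * f t) := by
  refine hf.bdd_mul (c := 1) (Continuous.aestronglyMeasurable (by fun_prop)) (.of_forall fun t => ?_)
  rw [norm_exp_neg_I_mul]

lemma hat_add (hf : Integrable f) (hg : Integrable g) (u : E d) :
    hat (fun x => f x + g x) u = hat f u + hat g u := by
  unfold hat
  rw [← integral_add (integrable_exp_mul hf u) (integrable_exp_mul hg u)]
  simp only [mul_add]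

lemma hat_smul (c : ℂ) (f : E d → ℂ) (u : E d) : hat (fun x => c * f x) u = c * hat f u := by
  unfold hat
  rw [← integral_const_mul]
  congr 1; ext t; ring

lemma hat_sub (hf : Integrable f) (hg : Integrable g) (u : E d) :
    hat (fun x => f x - g x) u = hat f u - hat g u := by
  have := hat_add hf (hg.const_mul (-1)) u
  rw [hat_smul] at this
  simpa [sub_eq_add_neg] using this

lemma norm_hat_le (f : E d → ℂ) (u : E d) : ‖hat f u‖ ≤ ∫ t, ‖f t‖ := by
  unfold hat
  refine (norm_integral_le_integral_norm _).trans (le_of_eq ?_)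
  congr 1; ext t
  rw [norm_mul, norm_exp_neg_I_mul, one_mul]

lemma continuous_hat (hf : Integrable f) : Continuous (hat f) := by
  refine continuous_of_dominated (bound := fun t => ‖f t‖)
    (fun u => (integrable_exp_mul hf u).aestronglyMeasurable) (fun u => .of_forall fun t => ?_)
    hf.norm (.of_forall fun t => by fun_prop)
  rw [norm_mul, norm_exp_neg_I_mul, one_mul]

lemma hat_translate (f : E d → ℂ) (y u : E d) :
    hat (fun x => f (x - y)) u = Complex.exp (-(Complex.I * ((inner ℝ u y : ℝ) : ℂ))) * hat f u := by
  unfold hat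
  rw [← integral_const_mul,
    ← integral_sub_right_eq_self
      (fun x => Complex.exp (-(Complex.I * ((inner ℝ u y : ℝ) : ℂ))) * _) y]
  congr 1; ext t
  rw [← mul_assoc, ← Complex.exp_add]
  congr 2
  rw [inner_sub_right]; push_cast; ring

lemma hat_modulate (v u : E d) (f : E d → ℂ) :
    hat (fun t => Complex.exp (Complex.I * ((inner ℝ v t : ℝ) : ℂ)) * f t) u = hat f (u - v) := by
  unfold hat
  congr 1; ext t
  rw [← mul_assoc, ← Complex.exp_add]
  congr 2
  rw [inner_sub_left]; push_cast; ring

lemma hat_neg_of_real (f : E d → ℝ) (u : E d) :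
    hat (fun x => (f x : ℂ)) (-u) = conj (hat (fun x => (f x : ℂ)) u) := by
  unfold hat
  rw [← integral_conj]
  congr 1; ext t
  simp [← Complex.exp_conj]

end Hat

/-! ### Square integrability of transforms and local finiteness of the spectral measure -/

section SpectralFinite

variable {d : ℕ} {S : Measure (E d)}

/-- All test functions have square integrable Fourier transforms. -/
def HatFinite (S : Measure (E d)) : Prop :=
  ∀ f : E d → ℝ, IsTest f → ∫⁻ u, ‖fourierHat f u‖ₑ ^ 2 ∂S < ⊤

lemma sq_eLpNorm_two {α F : Type*} [MeasurableSpace α] [NormedAddCommGroup F] (μ : Measure α)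
    (g : α → F) : eLpNorm g 2 μ ^ 2 = ∫⁻ u, ‖g u‖ₑ ^ 2 ∂μ := by
  rw [eLpNorm_eq_lintegral_rpow_enorm_toReal (by norm_num) (by norm_num), ← ENNReal.rpow_natCast,
    ← ENNReal.rpow_mul]
  simp

lemma memLp_two_iff_lintegral {g : E d → ℂ} (hg : Continuous g) :
    MemLp g 2 S ↔ ∫⁻ u, ‖g u‖ₑ ^ 2 ∂S < ⊤ := by
  rw [← sq_eLpNorm_two]
  exact ⟨fun h => ENNReal.pow_lt_top h.2, fun h => ⟨hg.aestronglyMeasurable, by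
    simpa [ENNReal.pow_lt_top_iff] using h⟩⟩

lemma HatFinite.memLp (hS : HatFinite S) {f : E d → ℂ} (hf : IsTestC f) : MemLp (hat f) 2 S := by
  have h1 := (memLp_two_iff_lintegral (continuous_hat hf.re.ofReal.integrable)).2 (hS _ hf.re)
  have h2 := (memLp_two_iff_lintegral (continuous_hat hf.im.ofReal.integrable)).2 (hS _ hf.im)
  refine (h1.add (h2.const_mul Complex.I)).ae_eq (.of_forall fun u => ?_)
  rw [Pi.add_apply, ← hat_smul, ← hat_add hf.re.ofReal.integrable
    (hf.im.ofReal.smul _).integrable]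
  congr 1; ext x
  rw [mul_comm]; exact Complex.re_add_im _

/-- A modulated ball indicator has a continuous transform that is nonzero at `v` and square
integrable for `S`; Chebyshev's inequality bounds the mass near `v`. -/
lemma HatFinite.isLocallyFiniteMeasure (hS : HatFinite S) : IsLocallyFiniteMeasure S := by
  refine ⟨fun v => ?_⟩
  set B : Set (E d) := Metric.closedBall 0 1
  have h1 : IsTestC (fun t : E d => ((B.indicator (fun _ => (1 : ℝ)) t : ℝ) : ℂ)) :=
    (isTest_indicator_one Metric.isClosed_closedBall.measurableSet Metric.isBounded_closedBall).ofReal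
  set f : E d → ℂ := fun t => Complex.exp (Complex.I * ((inner ℝ v t : ℝ) : ℂ)) *
    ((B.indicator (fun _ => (1 : ℝ)) t : ℝ) : ℂ)
  have hf : IsTestC f := by
    obtain ⟨C, hC⟩ := h1.bounded
    refine ⟨(Continuous.measurable (by fun_prop)).mul h1.measurable, ⟨C, fun x => ?_⟩,
      h1.support.subset ?_⟩
    · rw [norm_mul, mul_comm Complex.I, Complex.norm_exp_ofReal_mul_I, one_mul]; exact hC x
    · intro x hx hfx
      simp only [f, Function.mem_support] at hx
      exact hx (by beta_reduce at hfx; rw [hfx, mul_zero])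
  have hv : hat f v ≠ 0 := by
    rw [hat_modulate]
    simp only [hat, sub_self, inner_zero_left, Complex.ofReal_zero, mul_zero, neg_zero,
      Complex.exp_zero, one_mul]
    rw [integral_complex_ofReal, integral_indicator_const _ Metric.isClosed_closedBall.measurableSet]
    have : 0 < volume.real B :=
      ENNReal.toReal_pos (Metric.measure_closedBall_pos _ _ one_pos).ne' measure_closedBall_lt_top.ne
    simpa using this.ne'
  have hL := (memLp_two_iff_lintegral (continuous_hat hf.integrable)).1 (hS.memLp hf)
  have hc := continuous_hat hf.integrable
  refine ⟨{u | ‖hat f v‖ₑ / 2 ≤ ‖hat f u‖ₑ}, ?_, ?_⟩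
  · have hlt : ‖hat f v‖ₑ / 2 < ‖hat f v‖ₑ :=
      ENNReal.half_lt_self (by simpa using hv) (by simp)
    filter_upwards [hc.enorm.continuousAt.eventually (lt_mem_nhds hlt)] with u hu using hu.le
  · have hm := meas_ge_le_lintegral_div (μ := S) (f := fun u => ‖hat f u‖ₑ ^ 2)
      (hc.enorm.measurable.pow_const 2).aemeasurable (ε := (‖hat f v‖ₑ / 2) ^ 2) (by simpa using hv)
      (by simp [ENNReal.div_eq_top])
    refine (measure_mono fun u hu => ?_).trans_lt (hm.trans_lt (ENNReal.div_lt_top hL.ne (by simpa using hv)))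
    exact pow_le_pow_left' (show ‖hat f v‖ₑ / 2 ≤ ‖hat f u‖ₑ from hu) 2

end SpectralFinite
end SpectralRigidity
end

/-! ### Continuity of the Fourier transform from `C(K)` to `L²(S)` -/

noncomputable section
namespace SpectralRigidity
open scoped FourierTransform ENNReal NNReal ContDiff ComplexConjugate

section Extend

variable {d : ℕ} {K : Set (E d)}

/-- Extension by zero of a continuous function on `K`. -/
def extendZero (f : C(K, ℂ)) : E d → ℂ := Function.extend Subtype.val f 0

lemma extendZero_of_mem (f : C(K, ℂ)) {x : E d} (hx : x ∈ K) : extendZero f x = f ⟨x, hx⟩ :=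
  Subtype.val_injective.extend_apply f 0 ⟨x, hx⟩

lemma extendZero_of_notMem (f : C(K, ℂ)) {x : E d} (hx : x ∉ K) : extendZero f x = 0 :=
  Function.extend_apply' _ _ _ (by simpa using hx)

lemma extendZero_add (f g : C(K, ℂ)) :
    extendZero (f + g) = fun x => extendZero f x + extendZero g x := by
  ext x
  by_cases hx : x ∈ K
  · simp [extendZero_of_mem _ hx]
  · simp [extendZero_of_notMem _ hx]

lemma extendZero_smul (c : ℂ) (f : C(K, ℂ)) :
    extendZero (c • f) = fun x => c * extendZero f x := by
  ext x
  by_cases hx : x ∈ K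
  · simp [extendZero_of_mem _ hx]
  · simp [extendZero_of_notMem _ hx]

lemma norm_extendZero_le [CompactSpace K] (f : C(K, ℂ)) (x : E d) : ‖extendZero f x‖ ≤ ‖f‖ := by
  by_cases hx : x ∈ K
  · rw [extendZero_of_mem _ hx]; exact f.norm_coe_le_norm _
  · rw [extendZero_of_notMem _ hx]; simp

lemma isTestC_extendZero [CompactSpace K] (f : C(K, ℂ)) : IsTestC (extendZero f) := by
  have hK : IsCompact K := isCompact_iff_compactSpace.2 inferInstance
  refine ⟨?_, ⟨‖f‖, norm_extendZero_le f⟩, hK.isBounded.subset ?_⟩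
  · exact (MeasurableEmbedding.subtype_coe hK.measurableSet).measurable_extend
      f.continuous.measurable measurable_const
  · intro x hx
    by_contra h
    exact hx (extendZero_of_notMem f h)

lemma norm_hat_extendZero_le [CompactSpace K] (f : C(K, ℂ)) (u : E d) :
    ‖hat (extendZero f) u‖ ≤ volume.real K * ‖f‖ := by
  have hK : IsCompact K := isCompact_iff_compactSpace.2 inferInstance
  refine (norm_hat_le _ _).trans ?_
  have : ∫ t, ‖extendZero f t‖ ≤ ∫ t, K.indicator (fun _ => ‖f‖) t := by
    refine integral_mono (isTestC_extendZero f).integrable.norm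
      ((integrable_indicator_iff hK.measurableSet).2 (integrableOn_const hK.measure_lt_top.ne))
      fun t => ?_
    by_cases ht : t ∈ K
    · simpa [ht] using norm_extendZero_le f t
    · simp [ht, extendZero_of_notMem]
  rwa [integral_indicator_const _ hK.measurableSet, smul_eq_mul] at this

variable {S : Measure (E d)}

/-- The Fourier transform as a linear map from continuous functions on `K` to `L²(S)`. -/
def hatLp (hS : HatFinite S) (K : Set (E d)) [CompactSpace K] : C(K, ℂ) →ₗ[ℂ] Lp ℂ 2 S where
  toFun f := (hS.memLp (isTestC_extendZero f)).toLp
  map_add' f g := by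
    rw [← MemLp.toLp_add]
    congr 1; ext u
    rw [extendZero_add, hat_add (isTestC_extendZero f).integrable (isTestC_extendZero g).integrable]
    rfl
  map_smul' c f := by
    rw [RingHom.id_apply, ← MemLp.toLp_const_smul]
    congr 1; ext u
    rw [extendZero_smul, hat_smul]
    rfl

/-- By the closed graph theorem, the Fourier transform is bounded from continuous functions on a
compact set to `L²(S)`. -/
lemma continuous_hatLp (hS : HatFinite S) (K : Set (E d)) [CompactSpace K] :
    Continuous (hatLp hS K) := by
  refine (hatLp hS K).continuous_of_seq_closed_graph fun f g y hf hy => ?_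
  -- The `L²` limit is an almost everywhere limit along a subsequence, while uniform convergence on
  -- `K` makes the transforms converge pointwise; the two limits agree.
  have hmeas := tendstoInMeasure_of_tendsto_Lp hy
  obtain ⟨ns, hns, hlim⟩ := hmeas.exists_seq_tendsto_ae
  refine Lp.ext ?_
  have hall : ∀ᵐ u ∂S, ∀ n, (hatLp hS K (f n)) u = hat (extendZero (f n)) u :=
    ae_all_iff.2 fun n => (hS.memLp (isTestC_extendZero (f n))).coeFn_toLp
  filter_upwards [hlim, hall, (hS.memLp (isTestC_extendZero g)).coeFn_toLp] with u h1 h2 h3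
  refine tendsto_nhds_unique h1 ?_
  simp only [Function.comp_apply, h2]
  change Tendsto _ _ (𝓝 ((hS.memLp (isTestC_extendZero g)).toLp _ u))
  rw [h3]
  have h4 : Tendsto (fun n => hat (extendZero (f n)) u) atTop (𝓝 (hat (extendZero g) u)) := by
    rw [tendsto_iff_norm_sub_tendsto_zero]
    have h5 := (tendsto_iff_norm_sub_tendsto_zero.1 hf).const_mul (volume.real K)
    rw [mul_zero] at h5
    refine squeeze_zero (fun _ => norm_nonneg _) (fun n => ?_) h5
    have := norm_hat_extendZero_le (f n - g) u
    rwa [sub_eq_add_neg, ← neg_one_smul ℂ g, extendZero_add, extendZero_smul, hat_add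
      (isTestC_extendZero _).integrable ((isTestC_extendZero _).smul _).integrable, hat_smul,
      neg_one_mul, neg_one_smul, ← sub_eq_add_neg, ← sub_eq_add_neg] at this
  exact h4.comp hns.tendsto_atTop

end Extend

/-! ### Uniqueness for Fourier transforms of measures -/

section Uniqueness

variable {d : ℕ} {μ : Measure (E d)}

/-- An integrable function whose Fourier transform with respect to `μ` vanishes is zero. -/
lemma ae_eq_zero_of_forall_integral_exp_eq_zero [SigmaFinite μ] {f : E d → ℂ}
    (hf : Integrable f μ)
    (h : ∀ y : E d, ∫ u, Complex.exp (-(Complex.I * ((inner ℝ u y : ℝ) : ℂ))) * f u ∂μ = 0) :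
    ∀ᵐ u ∂μ, f u = 0 := by
  refine ae_eq_zero_of_integral_contDiff_smul_eq_zero hf.locallyIntegrable fun g hg hgs => ?_
  have hgc : HasCompactSupport (fun x => (g x : ℂ)) := hgs.comp_left (g := fun r : ℝ => (r : ℂ)) rfl
  have hgd : ContDiff ℝ ∞ (fun x => (g x : ℂ)) := Complex.ofRealCLM.contDiff.comp hg
  -- Writing the smooth test function as the transform of a Schwartz function `η` moves the
  -- transform onto `f dμ`, where it vanishes by assumption.
  set G : SchwartzMap (E d) ℂ := hgc.toSchwartzMap hgd
  set η : SchwartzMap (E d) ℂ := 𝓕⁻ G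
  have hη : (𝓕 (η : E d → ℂ)) = fun x => (g x : ℂ) := by
    rw [← SchwartzMap.fourier_coe, FourierTransform.fourier_fourierInv_eq]
    rfl
  have key := VectorFourier.integral_fourierIntegral_smul_eq_flip (μ := (volume : Measure (E d)))
    (ν := μ) (L := innerₗ (E d)) (f := (η : E d → ℂ)) (g := f) Real.continuous_fourierChar
    (by simp only [innerₗ_apply_apply]; fun_prop) η.integrable hf
  have hz : ∀ x, VectorFourier.fourierIntegral Real.fourierChar μ (innerₗ (E d)).flip f x = 0 := by
    intro x
    rw [← h ((2 * Real.pi) • x), Real.vector_fourierIntegral_eq_integral_exp_smul]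
    refine integral_congr_ae (.of_forall fun u => ?_)
    simp only [smul_eq_mul]
    congr 2
    simp [inner_smul_right, real_inner_comm]
    ring
  simp only [hz, smul_zero, integral_zero] at key
  rw [← key]
  refine integral_congr_ae (.of_forall fun u => ?_)
  have := congrFun hη u
  simp only [Complex.real_smul]
  rw [← this]
  rfl

end Uniqueness
end SpectralRigidity
end

/-! ### Functionals orthogonal to test functions off `A`, and their analytic densities -/

noncomputable section
namespace SpectralRigidity
open scoped FourierTransform ENNReal NNReal ContDiff ComplexConjugate

section Pairing

variable {d : ℕ} {S : Measure (E d)}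

/-- The pairing of the Fourier transform of `f` with `φ ∈ L²(S)`. -/
def pairing (φ : Lp ℂ 2 S) (f : E d → ℂ) : ℂ := ∫ u, conj (φ u) * hat f u ∂S

lemma HatFinite.integrable_pairing (hS : HatFinite S) (φ : Lp ℂ 2 S) {f : E d → ℂ}
    (hf : IsTestC f) : Integrable (fun u => conj (φ u) * hat f u) S :=
  (Lp.memLp φ).star.integrable_mul (hS.memLp hf)

lemma HatFinite.inner_toLp (hS : HatFinite S) (φ : Lp ℂ 2 S) {f : E d → ℂ} (hf : IsTestC f) :
    inner ℂ φ ((hS.memLp hf).toLp) = pairing φ f := by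
  rw [L2.inner_def]
  refine integral_congr_ae ?_
  filter_upwards [(hS.memLp hf).coeFn_toLp] with u hu
  rw [hu, RCLike.inner_apply, mul_comm]

lemma HatFinite.pairing_sub (hS : HatFinite S) (φ : Lp ℂ 2 S) {f g : E d → ℂ} (hf : IsTestC f)
    (hg : IsTestC g) : pairing φ (fun x => f x - g x) = pairing φ f - pairing φ g := by
  unfold pairing
  rw [← integral_sub (hS.integrable_pairing φ hf) (hS.integrable_pairing φ hg)]
  simp only [hat_sub hf.integrable hg.integrable, mul_sub]

/-- The pairing with `φ`, as a continuous functional on the continuous functions on `K`. -/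
def pairingCLM (hS : HatFinite S) (K : Set (E d)) [CompactSpace K] (φ : Lp ℂ 2 S) :
    C(K, ℂ) →L[ℂ] ℂ :=
  (innerSL ℂ φ).comp ⟨hatLp hS K, continuous_hatLp hS K⟩

lemma pairingCLM_apply (hS : HatFinite S) (K : Set (E d)) [CompactSpace K] (φ : Lp ℂ 2 S)
    (f : C(K, ℂ)) : pairingCLM hS K φ f = pairing φ (extendZero f) :=
  hS.inner_toLp φ (isTestC_extendZero f)

/-- `φ` is orthogonal to the Fourier transforms of the test functions that vanish on `A`. -/
def PairingVanishes (φ : Lp ℂ 2 S) (A : Set (E d)) : Prop :=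
  ∀ h : E d → ℂ, IsTestC h → (∀ x ∈ A, h x = 0) → pairing φ h = 0

/-- The difference of `f` and the extension of `g` by zero is a test function vanishing on `A`. This
is how discontinuous functions such as `1_A` are reached by a functional on `C(K)`. -/
lemma PairingVanishes.pairing_eq (hS : HatFinite S) {K A : Set (E d)} [CompactSpace K]
    {φ : Lp ℂ 2 S} (hφ : PairingVanishes φ A) (hAK : A ⊆ K) {f : E d → ℂ} (hf : IsTestC f)
    (g : C(K, ℂ)) (hfg : ∀ x : K, x.1 ∈ A → f x = g x) : pairing φ f = pairingCLM hS K φ g := by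
  rw [pairingCLM_apply, ← sub_eq_zero, ← hS.pairing_sub φ hf (isTestC_extendZero g)]
  refine hφ _ (hf.sub (isTestC_extendZero g)) fun x hx => ?_
  rw [extendZero_of_mem g (hAK hx), hfg ⟨x, hAK hx⟩ hx, sub_self]

/-- The character `x ↦ e^{i ⟨v, x⟩}` on `K`. -/
def charOn (K : Set (E d)) (v : E d) : C(K, ℂ) :=
  ⟨fun x => Complex.exp (Complex.I * ((inner ℝ v (x : E d) : ℝ) : ℂ)), by fun_prop⟩

lemma continuous_charOn (K : Set (E d)) [CompactSpace K] : Continuous (charOn K) := by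
  let g : C(E d × K, ℂ) :=
    ⟨fun p => Complex.exp (Complex.I * ((inner ℝ p.1 (p.2 : E d) : ℝ) : ℂ)), by fun_prop⟩
  exact g.curry.continuous

lemma norm_charOn_le (K : Set (E d)) [CompactSpace K] (v : E d) : ‖charOn K v‖ ≤ 1 := by
  refine (ContinuousMap.norm_le _ zero_le_one).2 fun x => ?_
  simp only [charOn, ContinuousMap.coe_mk]
  rw [mul_comm, Complex.norm_exp_ofReal_mul_I]

/-- Fourier inversion under a continuous functional. -/
lemma clm_restrict_eq_integral {K : Set (E d)} [CompactSpace K] (T : C(K, ℂ) →L[ℂ] ℂ)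
    {F : E d → ℂ} (hF : Continuous F) (hFi : Integrable F) (hFF : Integrable (𝓕 F)) :
    T ((⟨F, hF⟩ : C(E d, ℂ)).restrict K) =
      (((2 * Real.pi) ^ d)⁻¹ : ℝ) * ∫ u, hat F u * T (charOn K u) := by
  -- Fourier inversion is read as a Bochner integral in `C(K)`, so that the functional passes under
  -- the integral sign.
  have hint : Integrable (fun w : E d => 𝓕 F w • charOn K ((2 * Real.pi) • w)) := by
    have hc : Continuous fun w : E d => charOn K ((2 * Real.pi) • w) :=
      (continuous_charOn K).comp (by fun_prop)
    exact hFF.smul_bdd 1 hc.aestronglyMeasurable (.of_forall fun w => norm_charOn_le K _)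
  have h1 : (⟨F, hF⟩ : C(E d, ℂ)).restrict K = ∫ w, 𝓕 F w • charOn K ((2 * Real.pi) • w) := by
    ext x
    have := (ContinuousMap.evalCLM ℂ x : C(K, ℂ) →L[ℂ] ℂ).integral_comp_comm hint
    simp only [ContinuousMap.evalCLM_apply] at this
    rw [← this]
    have h2 := congrFun (hF.fourierInv_fourier_eq hFi hFF) (x : E d)
    rw [Real.fourierInv_eq'] at h2
    simp only [ContinuousMap.restrict_apply, ContinuousMap.coe_mk]
    rw [← h2]
    refine integral_congr_ae (.of_forall fun w => ?_)
    simp only [ContinuousMap.smul_apply, smul_eq_mul, charOn, ContinuousMap.coe_mk]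
    rw [mul_comm]
    congr 2
    rw [inner_smul_left]
    push_cast
    simp
    ring
  rw [h1, ← T.integral_comp_comm hint]
  have h3 := Measure.integral_comp_smul (volume : Measure (E d))
    (fun u => hat F u * T (charOn K u)) (2 * Real.pi)
  rw [finrank_euclideanSpace_fin, abs_of_nonneg (by have := Real.pi_pos; positivity),
    Complex.real_smul] at h3
  rw [← h3]
  refine integral_congr_ae (.of_forall fun w => ?_)
  simp only [map_smul, smul_eq_mul, fourier_eq_hat]

lemma IsTestC.translate {f : E d → ℂ} (hf : IsTestC f) (y : E d) : IsTestC fun x => f (x - y) := by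
  obtain ⟨C, hC⟩ := hf.bounded
  refine ⟨hf.measurable.comp (measurable_id.sub_const y), ⟨C, fun x => hC _⟩, ?_⟩
  obtain ⟨R, hR⟩ := hf.support.subset_closedBall 0
  refine (Metric.isBounded_closedBall (x := y) (r := R)).subset fun x hx => ?_
  have := hR (show x - y ∈ Function.support f from hx)
  simpa [dist_eq_norm] using this

/-- The measure `φ̄ dS` and the smooth measure of density `ψ` given by the values of the functional
on characters have the same windowed Fourier transform. -/
lemma PairingVanishes.integral_exp_eq (hS : HatFinite S) {K A : Set (E d)} [CompactSpace K]
    {φ : Lp ℂ 2 S} (hφ : PairingVanishes φ A) (hAK : A ⊆ K) {F : E d → ℂ} (hF : Continuous F)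
    (hFt : IsTestC F) (hFF : Integrable (𝓕 F)) (y : E d) :
    ∫ u, Complex.exp (-(Complex.I * ((inner ℝ u y : ℝ) : ℂ))) * (conj (φ u) * hat F u) ∂S =
    ∫ u, Complex.exp (-(Complex.I * ((inner ℝ u y : ℝ) : ℂ))) *
      ((((2 * Real.pi) ^ d)⁻¹ : ℝ) * (hat F u * pairingCLM hS K φ (charOn K u))) := by
  have hFy : Continuous fun x => F (x - y) := by fun_prop
  have h𝓕 : (𝓕 fun x => F (x - y)) = fun w => Complex.exp (-(Complex.I *
      ((inner ℝ ((2 * Real.pi) • w) y : ℝ) : ℂ))) * 𝓕 F w := by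
    ext w; rw [fourier_eq_hat, hat_translate, fourier_eq_hat]
  have hFFy : Integrable (𝓕 fun x => F (x - y)) := by
    rw [h𝓕]
    refine hFF.bdd_mul (c := 1) (Continuous.aestronglyMeasurable (by fun_prop))
      (.of_forall fun t => ?_)
    rw [norm_exp_neg_I_mul]
  -- Translating the window by `y` multiplies its transform by a character, so all translates
  -- together give a Fourier transform in `y`.
  have h1 := hφ.pairing_eq hS hAK (hFt.translate y)
    ((⟨fun x => F (x - y), hFy⟩ : C(E d, ℂ)).restrict K) fun x _ => rfl
  rw [clm_restrict_eq_integral _ hFy (hFt.translate y).integrable hFFy, pairing,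
    ← integral_const_mul] at h1
  refine Eq.trans ?_ (h1.trans ?_)
  · refine integral_congr_ae (.of_forall fun u => ?_)
    simp only [hat_translate]; ring
  · refine integral_congr_ae (.of_forall fun u => ?_)
    simp only [hat_translate]; ring

lemma integrable_exp_mul' {μ : Measure (E d)} {f : E d → ℂ} (hf : Integrable f μ) (y : E d) :
    Integrable (fun u => Complex.exp (-(Complex.I * ((inner ℝ u y : ℝ) : ℂ))) * f u) μ := by
  refine hf.bdd_mul (c := 1) (Continuous.aestronglyMeasurable (by fun_prop)) (.of_forall fun t => ?_)
  rw [norm_exp_neg_I_mul]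

/-- If `φ` is orthogonal to the Fourier transforms of the test functions vanishing on the bounded
set `A`, then `φ̄ dS` is absolutely continuous, with the density `ψ` given by characters. -/
lemma PairingVanishes.density_eq (hS : HatFinite S) {s : E d → ℝ} (hs : IsSpectralDensity S s)
    {K A : Set (E d)} [CompactSpace K]
    {φ : Lp ℂ 2 S} (hφ : PairingVanishes φ A) (hAK : A ⊆ K) {F : E d → ℂ} (hF : Continuous F)
    (hFt : IsTestC F) (hFF : Integrable (𝓕 F)) :
    ∀ᵐ u, hat F u ≠ 0 → conj (φ u) * s u =
      (((2 * Real.pi) ^ d)⁻¹ : ℝ) * pairingCLM hS K φ (charOn K u) := by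
  have : IsLocallyFiniteMeasure S := hS.isLocallyFiniteMeasure
  obtain ⟨hsm, hs0, ν, hν, hSν⟩ := hs
  have hνS : ν ≤ S := by rw [hSν]; exact Measure.le_add_left le_rfl
  have : IsLocallyFiniteMeasure ν := Measure.isLocallyFiniteMeasure_of_le hνS
  -- `N` is null for the singular part `ν` and has full Lebesgue measure.
  obtain ⟨N, hN, hνN, hvN⟩ := hν
  classical
  set c : ℂ := ((((2 * Real.pi) ^ d)⁻¹ : ℝ) : ℂ)
  set ψ : E d → ℂ := fun u => pairingCLM hS K φ (charOn K u)
  have hψc : Continuous ψ := (pairingCLM hS K φ).continuous.comp (continuous_charOn K)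
  set a : E d → ℂ := fun u => conj (φ u) * hat F u
  set b : E d → ℂ := fun u => c * (hat F u * ψ u)
  have haS : Integrable a S := hS.integrable_pairing φ hFt
  have haν : Integrable a ν := haS.mono_measure hνS
  have hav : Integrable a (volume.withDensity fun u => ENNReal.ofReal (s u)) :=
    haS.mono_measure (by rw [hSν]; exact Measure.le_add_right le_rfl)
  have hav' : Integrable (fun u => (s u : ℂ) * a u) := by
    have := (integrable_withDensity_iff_integrable_smul' hsm.ennreal_ofReal
      (.of_forall fun u => ENNReal.ofReal_lt_top)).1 hav
    simpa [ENNReal.toReal_ofReal (hs0 _), Complex.real_smul] using this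
  have hhat : Integrable (hat F) := by
    have h1 : hat F = fun u => 𝓕 F ((2 * Real.pi)⁻¹ • u) := funext (hat_eq_fourier F)
    rw [h1]
    exact hFF.comp_smul (by have := Real.pi_pos; positivity)
  have hb : Integrable b := by
    refine Integrable.const_mul ?_ c
    refine hhat.mul_bdd (c := ‖pairingCLM hS K φ‖) hψc.aestronglyMeasurable (.of_forall fun u => ?_)
    refine ((pairingCLM hS K φ).le_opNorm _).trans ?_
    simpa using mul_le_mul_of_nonneg_left (norm_charOn_le K u) (norm_nonneg (pairingCLM hS K φ))
  -- The complex measure `a dS - b du` is encoded as one density with respect to `volume + ν`, so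
  -- that the uniqueness lemma applies to it. The window factor `hat F` makes it finite: `φ̄ dS`
  -- itself need not be.
  set f : E d → ℂ := N.piecewise (fun u => (s u : ℂ) * a u - b u) a
  have hfv : f =ᵐ[volume] fun u => (s u : ℂ) * a u - b u := by
    have : ∀ᵐ u, u ∈ N := by rw [ae_iff]; exact hvN
    filter_upwards [this] with u hu using Set.piecewise_eq_of_mem _ _ _ hu
  have hfν : f =ᵐ[ν] a := by
    have : ∀ᵐ u ∂ν, u ∉ N := by simpa [ae_iff] using hνN
    filter_upwards [this] with u hu using Set.piecewise_eq_of_notMem _ _ _ hu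
  have hfiv : Integrable f volume := (hav'.sub hb).congr hfv.symm
  have hfiν : Integrable f ν := haν.congr hfν.symm
  have key := ae_eq_zero_of_forall_integral_exp_eq_zero (μ := volume + ν) (f := f)
    (hfiv.add_measure hfiν) fun y => by
      rw [integral_add_measure (integrable_exp_mul' hfiv y) (integrable_exp_mul' hfiν y)]
      have e1 : ∫ u, Complex.exp (-(Complex.I * ((inner ℝ u y : ℝ) : ℂ))) * f u =
          (∫ u, Complex.exp (-(Complex.I * ((inner ℝ u y : ℝ) : ℂ))) * ((s u : ℂ) * a u)) -
          ∫ u, Complex.exp (-(Complex.I * ((inner ℝ u y : ℝ) : ℂ))) * b u := by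
        rw [← integral_sub (integrable_exp_mul' hav' y) (integrable_exp_mul' hb y)]
        refine integral_congr_ae ?_
        filter_upwards [hfv] with u hu
        rw [hu, mul_sub]
      have e2 : ∫ u, Complex.exp (-(Complex.I * ((inner ℝ u y : ℝ) : ℂ))) * f u ∂ν =
          ∫ u, Complex.exp (-(Complex.I * ((inner ℝ u y : ℝ) : ℂ))) * a u ∂ν := by
        refine integral_congr_ae ?_
        filter_upwards [hfν] with u hu
        rw [hu]
      have e3 := hφ.integral_exp_eq hS hAK hF hFt hFF y
      have e4 : ∫ u, Complex.exp (-(Complex.I * ((inner ℝ u y : ℝ) : ℂ))) * a u ∂S =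
          (∫ u, Complex.exp (-(Complex.I * ((inner ℝ u y : ℝ) : ℂ))) * ((s u : ℂ) * a u)) +
          ∫ u, Complex.exp (-(Complex.I * ((inner ℝ u y : ℝ) : ℂ))) * a u ∂ν := by
        conv_lhs => rw [hSν]
        rw [integral_add_measure (integrable_exp_mul' hav y) (integrable_exp_mul' haν y),
          integral_withDensity_eq_integral_toReal_smul hsm.ennreal_ofReal
            (.of_forall fun u => ENNReal.ofReal_lt_top)]
        congr 1
        refine integral_congr_ae (.of_forall fun u => ?_)
        simp only [ENNReal.toReal_ofReal (hs0 _), Complex.real_smul]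
        ring
      rw [e1, e2]
      linear_combination e3 - e4
  have key' : ∀ᵐ u, f u = 0 := ae_mono (Measure.le_add_right le_rfl) key
  filter_upwards [key', hfv] with u h1 h2 h3
  rw [h1] at h2
  refine mul_right_cancel₀ h3 ?_
  simp only [a, b] at h2
  linear_combination -h2

end Pairing
end SpectralRigidity
end

/-! ### Vanishing on the zero line and analytic continuation to the origin -/

noncomputable section
namespace SpectralRigidity
open scoped FourierTransform ENNReal NNReal ContDiff ComplexConjugate

section Line

variable {d : ℕ}

/-- A window function whose Fourier transform does not vanish at `v`. -/
lemma exists_window (v : E d) : ∃ F : E d → ℂ, Continuous F ∧ IsTestC F ∧ Integrable (𝓕 F) ∧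
    hat F v ≠ 0 := by
  let b : ContDiffBump (0 : E d) := ⟨1, 2, one_pos, one_lt_two⟩
  set F : E d → ℂ := fun t => Complex.exp (Complex.I * ((inner ℝ v t : ℝ) : ℂ)) * ((b t : ℝ) : ℂ)
    with hFdef
  have hb : HasCompactSupport fun t => ((b t : ℝ) : ℂ) :=
    b.hasCompactSupport.comp_left (g := fun r : ℝ => (r : ℂ)) rfl
  have hsupp : HasCompactSupport F := hb.mul_left
  have hsm : ContDiff ℝ ∞ F := by
    refine ContDiff.mul ?_ (Complex.ofRealCLM.contDiff.comp b.contDiff)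
    refine Complex.contDiff_exp.comp (contDiff_const.mul (Complex.ofRealCLM.contDiff.comp ?_))
    exact (innerSL ℝ v).contDiff
  have hc : Continuous F := hsm.continuous
  refine ⟨F, hc, ⟨hc.measurable, hsupp.exists_bound_of_continuous hc,
    hsupp.isCompact.isBounded.subset (subset_tsupport F)⟩, ?_, ?_⟩
  · have := (𝓕 (hsupp.toSchwartzMap hsm)).integrable (μ := (volume : Measure (E d)))
    rwa [SchwartzMap.fourier_coe] at this
  · rw [hFdef, hat_modulate]
    simp only [hat, sub_self, inner_zero_left, Complex.ofReal_zero, mul_zero, neg_zero,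
      Complex.exp_zero, one_mul]
    rw [integral_complex_ofReal]
    exact_mod_cast b.integral_pos.ne'

/-- A functional on continuous functions depends analytically on the frequency of a character. -/
lemma analyticOnNhd_clm_charOn {K : Set (E d)} [CompactSpace K] (T : C(K, ℂ) →L[ℂ] ℂ) (v : E d) :
    AnalyticOnNhd ℝ (fun t : ℝ => T (charOn K (t • v))) Set.univ := by
  -- In the Banach algebra `C(K)` the characters are the exponentials `exp (t • X)`, which are
  -- analytic in `t`.
  let X : C(K, ℂ) := ⟨fun x => Complex.I * ((inner ℝ v (x : E d) : ℝ) : ℂ), by fun_prop⟩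
  have hX : ∀ t : ℝ, charOn K (t • v) = NormedSpace.exp (t • X) := by
    intro t
    ext x
    have h := NormedSpace.map_exp (ContinuousMap.evalAlgHom ℂ ℂ x : C(K, ℂ) →ₐ[ℂ] ℂ)
      (continuous_eval_const x) (t • X)
    change NormedSpace.exp (t • X) x = NormedSpace.exp ((t • X) x) at h
    rw [h, ← Complex.exp_eq_exp_ℂ]
    simp only [charOn, ContinuousMap.coe_mk, ContinuousMap.smul_apply, X, Complex.real_smul,
      inner_smul_left]
    congr 1
    push_cast
    simp
    ring
  intro t _
  simp only [hX]
  have h1 : AnalyticAt ℝ (fun t : ℝ => t • X) t := analyticAt_id.smul analyticAt_const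
  have h2 : AnalyticAt ℝ (fun t : ℝ => NormedSpace.exp (t • X)) t :=
    AnalyticAt.fun_comp (f := fun t : ℝ => t • X) (NormedSpace.exp_analytic (𝕂 := ℝ) (t • X)) h1
  exact ((T.restrictScalars ℝ).analyticAt _).fun_comp h2

lemma volume_box (t r η : ℝ) : volume {u : E 2 | u 0 ∈ Set.Ioo (t - r) (t + r) ∧ u 1 ∈ Set.Ioo 0 η} =
    ENNReal.ofReal (2 * r) * ENNReal.ofReal η := by
  have h := (PiLp.volume_preserving_ofLp (Fin 2)).measure_preimage
    (s := Set.pi Set.univ fun i => Set.Ioo (![t - r, 0] i) (![t + r, η] i))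
    (MeasurableSet.univ_pi fun i => measurableSet_Ioo).nullMeasurableSet
  rw [Real.volume_pi_Ioo, Fin.prod_univ_two] at h
  convert h using 2
  · ext u
    simp [Fin.forall_fin_two]
  · simp only [Matrix.cons_val_zero]
    congr 1; ring
  · simp

lemma exists_box_subset {v : E 2} {p : E 2 → Prop} (h : ∀ᶠ u in 𝓝 v, p u) :
    ∃ r > 0, ∀ u : E 2, |u 0 - v 0| < r → |u 1 - v 1| < r → p u := by
  obtain ⟨ε, hε, hb⟩ := Metric.eventually_nhds_iff.1 h
  refine ⟨ε / 2, by positivity, fun u h0 h1 => hb ?_⟩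
  rw [dist_eq_norm, EuclideanSpace.norm_eq, Fin.sum_univ_two, Real.sqrt_lt' hε]
  simp only [PiLp.sub_apply, Real.norm_eq_abs]
  nlinarith [abs_nonneg (u 0 - v 0), abs_nonneg (u 1 - v 1)]

/-- A continuous density of an `L²(s du)` function times `s` vanishes on the zero line of `s`. -/
lemma eq_zero_of_density {S : Measure (E 2)} {s : E 2 → ℝ} (hs : IsSpectralDensity S s)
    (φ : Lp ℂ 2 S) {ψ : E 2 → ℂ} (hψ : Continuous ψ) {v : E 2} (hv : v 1 = 0)
    (hsv : ∀ᶠ u in 𝓝 v, s u = u 1 ^ 2)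
    {U : Set (E 2)} (hU : U ∈ 𝓝 v) (hae : ∀ᵐ u, u ∈ U → conj (φ u) * s u = ψ u) : ψ v = 0 := by
  by_contra hne
  have hδ : 0 < ‖ψ v‖ / 2 := by positivity
  set δ := ‖ψ v‖ / 2
  have hgood : ∀ᶠ u in 𝓝 v, (s u = u 1 ^ 2 ∧ u ∈ U) ∧ δ < ‖ψ u‖ :=
    (hsv.and hU).and (hψ.norm.continuousAt.eventually (lt_mem_nhds (half_lt_self (by positivity))))
  obtain ⟨r, hr, hbox⟩ := exists_box_subset hgood
  have hM : ∫⁻ u, ‖φ u‖ₑ ^ 2 ∂S < ⊤ := by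
    rw [← sq_eLpNorm_two]; exact ENNReal.pow_lt_top (Lp.memLp φ).2
  obtain ⟨hsm, hs0, ν, hν, hSν⟩ := hs
  set m := (∫⁻ u, ‖φ u‖ₑ ^ 2 ∂S).toReal
  have hm : ∫⁻ u, ‖φ u‖ₑ ^ 2 * ENNReal.ofReal (s u) ≤ ENNReal.ofReal m := by
    rw [ENNReal.ofReal_toReal hM.ne]
    calc ∫⁻ u, ‖φ u‖ₑ ^ 2 * ENNReal.ofReal (s u)
        = ∫⁻ u, ‖φ u‖ₑ ^ 2 ∂(volume.withDensity fun u => ENNReal.ofReal (s u)) := by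
          rw [lintegral_withDensity_eq_lintegral_mul _ hsm.ennreal_ofReal
            ((Lp.stronglyMeasurable φ).measurable.enorm.pow_const 2)]
          simp [mul_comm]
      _ ≤ ∫⁻ u, ‖φ u‖ₑ ^ 2 ∂S :=
          lintegral_mono' (by conv_rhs => rw [hSν]
                              exact Measure.le_add_right le_rfl) le_rfl
  -- On the box of width `2r` and height `η` above the zero line, `δ² ≤ |φ s|² ≤ η² |φ|² s`.
  -- Integrating over area `2rη` and dividing by `η` leaves a bound that fails as `η → 0`.
  have hkey : ∀ η, 0 < η → η < r → δ ^ 2 * (2 * r) ≤ η * m := by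
    intro η hη hηr
    set B : Set (E 2) := {u : E 2 | u 0 ∈ Set.Ioo (v 0 - r) (v 0 + r) ∧ u 1 ∈ Set.Ioo 0 η}
    have hBm : MeasurableSet B := by
      have h0 : Measurable fun u : E 2 => u 0 := by fun_prop
      have h1 : Measurable fun u : E 2 => u 1 := by fun_prop
      exact (h0 measurableSet_Ioo).inter (h1 measurableSet_Ioo)
    have h1 : ENNReal.ofReal (δ ^ 2) * volume B ≤ ENNReal.ofReal (η ^ 2) * ENNReal.ofReal m := by
      calc ENNReal.ofReal (δ ^ 2) * volume B = ∫⁻ u in B, ENNReal.ofReal (δ ^ 2) := by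
            rw [setLIntegral_const]
        _ ≤ ∫⁻ u in B, ENNReal.ofReal (η ^ 2) * (‖φ u‖ₑ ^ 2 * ENNReal.ofReal (s u)) := by
            refine setLIntegral_mono_ae' hBm ?_
            filter_upwards [hae] with u hu huB
            obtain ⟨⟨hsu, huU⟩, hδu⟩ := hbox u (by
              rw [abs_lt]; constructor <;> [linarith [huB.1.1]; linarith [huB.1.2]]) (by
              rw [hv, sub_zero, abs_lt]; constructor <;> [linarith [huB.2.1]; linarith [huB.2.2]])
            have h2 := congrArg norm (hu huU)
            rw [norm_mul, RCLike.norm_conj, Complex.norm_real, Real.norm_of_nonneg (hs0 u)] at h2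
            rw [← ofReal_norm, ← ENNReal.ofReal_pow (norm_nonneg _), ← ENNReal.ofReal_mul (by positivity),
              ← ENNReal.ofReal_mul (by positivity)]
            refine ENNReal.ofReal_le_ofReal ?_
            have h3 : δ ^ 2 ≤ (‖φ u‖ * s u) ^ 2 := by
              rw [h2]; exact pow_le_pow_left₀ hδ.le hδu.le 2
            have h4 : s u ≤ η ^ 2 := by
              rw [hsu]; exact pow_le_pow_left₀ huB.2.1.le huB.2.2.le 2
            have h5 : 0 ≤ ‖φ u‖ ^ 2 * s u := mul_nonneg (by positivity) (hs0 u)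
            nlinarith
        _ ≤ ∫⁻ u, ENNReal.ofReal (η ^ 2) * (‖φ u‖ₑ ^ 2 * ENNReal.ofReal (s u)) :=
            setLIntegral_le_lintegral _ _
        _ ≤ _ := by
            rw [lintegral_const_mul' _ _ ENNReal.ofReal_ne_top]
            gcongr
    rw [volume_box, ← ENNReal.ofReal_mul (by positivity), ← ENNReal.ofReal_mul (by positivity),
      ← ENNReal.ofReal_mul (by positivity), ENNReal.ofReal_le_ofReal_iff (by positivity)] at h1
    have : η * (δ ^ 2 * (2 * r)) ≤ η * (η * m) := by linarith
    exact le_of_mul_le_mul_left this hη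
  have hm0 : 0 ≤ m := ENNReal.toReal_nonneg
  have hpos : 0 < δ ^ 2 * (2 * r) := by positivity
  -- The second entry gives `2η(m+1) ≤ δ²·2r`, contradicting `δ²·2r ≤ ηm`; `m + 1` avoids division
  -- by zero.
  set η := min (r / 2) (δ ^ 2 * (2 * r) / (2 * (m + 1)))
  have hη : 0 < η := lt_min (by positivity) (by positivity)
  have h1 := hkey η hη ((min_le_left _ _).trans_lt (half_lt_self hr))
  have h2 : η * (2 * (m + 1)) ≤ δ ^ 2 * (2 * r) :=
    (le_div_iff₀ (by positivity)).1 (min_le_right _ _)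
  nlinarith

/-- A frequency zero line away from the origin forces the orthogonality to `1_A`. -/
lemma PairingVanishes.pairing_indicator_eq_zero {S : Measure (E 2)} (hS : HatFinite S)
    {s : E 2 → ℝ} (hs : IsSpectralDensity S s)
    (hline : ∀ᶠ u in 𝓝 (!₂[1, 0] : E 2), s u = u 1 ^ 2) {A : Set (E 2)} (hA : MeasurableSet A)
    (hAb : Bornology.IsBounded A) {φ : Lp ℂ 2 S} (hφ : PairingVanishes φ A) :
    pairing φ (fun x => ((A.indicator (fun _ => (1 : ℝ)) x : ℝ) : ℂ)) = 0 := by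
  obtain ⟨R, hR⟩ := hAb.subset_closedBall 0
  set K : Set (E 2) := Metric.closedBall 0 R
  have : CompactSpace K := isCompact_iff_compactSpace.1 (isCompact_closedBall _ _)
  set e : E 2 := !₂[1, 0]
  set T := pairingCLM hS K φ
  have hψc : Continuous fun u => T (charOn K u) := T.continuous.comp (continuous_charOn K)
  obtain ⟨F, hFc, hFt, hFF, hFe⟩ := exists_window e
  have hae := hφ.density_eq hS hs hR hFc hFt hFF
  have hFnhd : ∀ᶠ u in 𝓝 e, hat F u ≠ 0 :=
    (continuous_hat hFt.integrable).continuousAt.eventually_ne hFe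
  -- The argument works at every point of the zero line near `e`, not just at `e`: the identity
  -- theorem needs a whole interval of zeros.
  have hzero : ∀ᶠ v in 𝓝 e, v 1 = 0 → T (charOn K v) = 0 := by
    filter_upwards [hline.eventually_nhds, hFnhd.eventually_nhds] with v h1 h2 hv
    have hc : ((((2 * Real.pi) ^ 2)⁻¹ : ℝ) : ℂ) ≠ 0 := by
      simp
    have := eq_zero_of_density hs φ (continuous_const.mul hψc) hv h1 h2 hae
    exact (mul_eq_zero.1 this).resolve_left hc
  have hline' : ∀ᶠ t : ℝ in 𝓝 1, T (charOn K (t • e)) = 0 := by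
    have hcont : Tendsto (fun t : ℝ => t • e) (𝓝 1) (𝓝 e) := by
      have : Continuous fun t : ℝ => t • e := by fun_prop
      simpa using this.tendsto 1
    filter_upwards [hcont.eventually hzero] with t ht
    exact ht (by simp [e])
  -- Continuation along `t ↦ t • e` from `t = 1` to `t = 0`, where the character is the constant `1`
  -- and agrees with the indicator on `A`.
  have hall := (analyticOnNhd_clm_charOn T e).eqOn_zero_of_preconnected_of_eventuallyEq_zero
    isPreconnected_univ (Set.mem_univ (1 : ℝ)) hline' (Set.mem_univ (0 : ℝ))
  rw [hφ.pairing_eq hS hR (isTest_indicator_one hA hAb).ofReal (charOn K ((0 : ℝ) • e))]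
  · exact hall
  · intro x hx
    simp [charOn, hx]

end Line
end SpectralRigidity
end

/-! ### Approximation in `L²(S)` by real test functions vanishing on `A` -/

noncomputable section
namespace SpectralRigidity
open scoped FourierTransform ENNReal NNReal ComplexConjugate

section Approximation

variable {d : ℕ} {S : Measure (E d)}

/-- The Fourier transforms of the test functions that vanish on `A`, as a subspace of `L²(S)`. -/
def hatSubspace (hS : HatFinite S) (A : Set (E d)) : Submodule ℂ (Lp ℂ 2 S) where
  carrier := {g | ∃ (h : E d → ℂ) (hh : IsTestC h), (∀ x ∈ A, h x = 0) ∧ g = (hS.memLp hh).toLp}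
  zero_mem' := by
    refine ⟨fun _ => 0, ⟨measurable_const, ⟨0, by simp⟩, by simp [Function.support]⟩,
      fun _ _ => rfl, ?_⟩
    rw [eq_comm, ← MemLp.toLp_zero (MemLp.zero (p := 2) (μ := S) (ε := ℂ))]
    congr 1; ext u; simp [hat]
  add_mem' := by
    rintro _ _ ⟨h, hh, hA, rfl⟩ ⟨k, hk, kA, rfl⟩
    refine ⟨_, hh.add hk, fun x hx => by simp [hA x hx, kA x hx], ?_⟩
    rw [← MemLp.toLp_add]
    congr 1; ext u
    rw [hat_add hh.integrable hk.integrable]; rfl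
  smul_mem' := by
    rintro c _ ⟨h, hh, hA, rfl⟩
    refine ⟨_, hh.smul c, fun x hx => by simp [hA x hx], ?_⟩
    rw [← MemLp.toLp_const_smul]
    congr 1; ext u
    rw [hat_smul]; rfl

/-- If `γ̂` is orthogonal to all `φ` that are orthogonal to the Fourier transforms of test functions
vanishing on `A`, then these approximate `γ̂`. -/
lemma HatFinite.exists_eLpNorm_lt (hS : HatFinite S) {A : Set (E d)} {γ : E d → ℂ} (hγ : IsTestC γ)
    (h : ∀ φ : Lp ℂ 2 S, PairingVanishes φ A → pairing φ γ = 0) {ε : ℝ≥0∞} (hε : ε ≠ 0) :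
    ∃ h, IsTestC h ∧ (∀ x ∈ A, h x = 0) ∧ eLpNorm (hat fun x => γ x - h x) 2 S < ε := by
  have hmem : (hS.memLp hγ).toLp ∈ (hatSubspace hS A)ᗮᗮ := by
    rw [Submodule.mem_orthogonal]
    intro φ hφ
    rw [hS.inner_toLp φ hγ]
    refine h φ fun k hk hkA => ?_
    rw [← hS.inner_toLp φ hk]
    exact (Submodule.mem_orthogonal' _ _).1 hφ _ ⟨k, hk, hkA, rfl⟩
  rw [Submodule.orthogonal_orthogonal_eq_closure] at hmem
  obtain ⟨_, ⟨k, hk, hkA, rfl⟩, hd⟩ :=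
    EMetric.mem_closure_iff.1 (show _ ∈ closure (hatSubspace hS A : Set (Lp ℂ 2 S)) from hmem) ε hε.bot_lt
  refine ⟨k, hk, hkA, ?_⟩
  rw [Lp.edist_toLp_toLp] at hd
  convert hd using 2
  ext u
  rw [hat_sub hγ.integrable hk.integrable]; rfl

/-- For an even measure, the Fourier transforms of the real and imaginary part are orthogonal. -/
lemma lintegral_hat_re_le (heven : S.map (fun u => -u) = S) {f : E d → ℂ} (hf : IsTestC f) :
    ∫⁻ u, ‖fourierHat (fun x => (f x).re) u‖ₑ ^ 2 ∂S ≤ ∫⁻ u, ‖hat f u‖ₑ ^ 2 ∂S := by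
  set a : E d → ℂ := hat fun x => ((f x).re : ℂ)
  set b : E d → ℂ := hat fun x => ((f x).im : ℂ)
  have hac : Continuous a := continuous_hat hf.re.ofReal.integrable
  have hbc : Continuous b := continuous_hat hf.im.ofReal.integrable
  have hab : ∀ u, hat f u = a u + Complex.I * b u := by
    intro u
    simp only [a, b]
    rw [← hat_smul, ← hat_add hf.re.ofReal.integrable (hf.im.ofReal.smul _).integrable]
    congr 1; ext x
    rw [mul_comm]; exact (Complex.re_add_im _).symm
  -- Reflecting `u` conjugates `a` and `b` but not the factor `I`. Averaging the two sides by the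
  -- parallelogram law then discards the `b` term.
  have hsymm : ∫⁻ u, ‖a u - Complex.I * b u‖ₑ ^ 2 ∂S = ∫⁻ u, ‖a u + Complex.I * b u‖ₑ ^ 2 ∂S := by
    conv_rhs => rw [← heven]
    rw [lintegral_map ((by fun_prop : Continuous fun u => a u + Complex.I * b u).enorm.measurable.pow_const 2)
      measurable_neg]
    refine lintegral_congr fun u => ?_
    have h1 : a (-u) = conj (a u) := hat_neg_of_real _ u
    have h2 : b (-u) = conj (b u) := hat_neg_of_real _ u
    have : a (-u) + Complex.I * b (-u) = conj (a u - Complex.I * b u) := by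
      rw [h1, h2]; simp
    rw [this, RCLike.enorm_conj]
  have h2 : 2 * ∫⁻ u, ‖a u‖ₑ ^ 2 ∂S ≤ 2 * ∫⁻ u, ‖a u + Complex.I * b u‖ₑ ^ 2 ∂S := by
    nth_rw 2 [two_mul]
    nth_rw 1 [← hsymm]
    rw [← lintegral_add_left ((by fun_prop : Continuous fun u => a u - Complex.I * b u).enorm.measurable.pow_const 2),
      ← lintegral_const_mul' _ _ (by norm_num)]
    refine lintegral_mono fun u => ?_
    have h3 := parallelogram_law_with_norm ℝ (a u) (Complex.I * b u)
    simp only [← ofReal_norm]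
    rw [← ENNReal.ofReal_pow (norm_nonneg _), ← ENNReal.ofReal_pow (norm_nonneg _),
      ← ENNReal.ofReal_pow (norm_nonneg _), ← ENNReal.ofReal_add (by positivity) (by positivity),
      show (2 : ℝ≥0∞) = ENNReal.ofReal 2 by simp, ← ENNReal.ofReal_mul (by norm_num)]
    refine ENNReal.ofReal_le_ofReal ?_
    nlinarith [mul_self_nonneg ‖Complex.I * b u‖]
  simp only [hab]
  exact (ENNReal.mul_le_mul_iff_right (by norm_num) (by norm_num)).1 h2

/-- Approximation of the indicator of `A` by test functions that vanish on `A`. -/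
theorem exists_test_lintegral_lt {S : Measure (E 2)} (hS : HatFinite S)
    (heven : S.map (fun u => -u) = S) {s : E 2 → ℝ} (hs : IsSpectralDensity S s)
    (hline : ∀ᶠ u in 𝓝 (!₂[1, 0] : E 2), s u = u 1 ^ 2) {A : Set (E 2)} (hA : MeasurableSet A)
    (hAb : Bornology.IsBounded A) {ε : ℝ≥0∞} (hε : ε ≠ 0) :
    ∃ h, IsTestOn Aᶜ h ∧
      ∫⁻ u, ‖fourierHat (fun x => A.indicator (fun _ => 1) x - h x) u‖ₑ ^ 2 ∂S < ε := by
  have hγ := (isTest_indicator_one hA hAb).ofReal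
  -- Capping the norm at `1` makes its square no larger than the norm, hence below `ε`.
  obtain ⟨h, hh, hhA, hlt⟩ := hS.exists_eLpNorm_lt hγ
    (fun φ hφ => hφ.pairing_indicator_eq_zero hS hs hline hA hAb) (ε := min ε 1)
    (by simp [hε])
  refine ⟨fun x => (h x).re, ⟨hh.re, fun x hx hxA => hx (by simp [hhA x hxA])⟩, ?_⟩
  have h1 := lintegral_hat_re_le heven (hγ.sub hh)
  simp only [Complex.sub_re, Complex.ofReal_re] at h1
  refine h1.trans_lt ?_
  rw [← sq_eLpNorm_two]
  refine lt_of_le_of_lt ?_ (hlt.trans_le (min_le_left _ _))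
  rw [sq]
  exact mul_le_of_le_one_right' (hlt.le.trans (min_le_right _ _))

end Approximation

/-! ### From spectral estimates to random variables -/

section RandomMeasure

lemma fourierHat_zero {d : ℕ} (f : E d → ℝ) : fourierHat f 0 = ((∫ x, f x : ℝ) : ℂ) := by
  simp only [fourierHat, inner_zero_left, Complex.ofReal_zero, mul_zero, neg_zero,
    Complex.exp_zero, one_mul]
  exact integral_complex_ofReal

variable {d : ℕ} {Ω : Type*} [MeasurableSpace Ω] {P : Measure Ω}

lemma StationaryRandomMeasure.ae_sub (M : StationaryRandomMeasure d P) {f g : E d → ℝ}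
    (hf : IsTest f) (hg : IsTest g) :
    ∀ᵐ ω ∂P, M.I (fun x => f x - g x) ω = M.I f ω - M.I g ω := by
  filter_upwards [M.linear 1 (-1) f g hf hg] with ω h
  simpa [sub_eq_add_neg] using h

lemma StationaryRandomMeasure.variance_sub (M : StationaryRandomMeasure d P) {f g : E d → ℝ}
    (hf : IsTest f) (hg : IsTest g) :
    Var[fun ω => M.I f ω - M.I g ω; P] = Var[M.I fun x => f x - g x; P] :=
  (variance_congr (M.ae_sub hf hg)).symm

lemma StationaryRandomMeasure.IsSpectralMeasure.hatFinite {M : StationaryRandomMeasure d P}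
    {S : Measure (E d)} (h : M.IsSpectralMeasure S) : HatFinite S := by
  intro f hf
  rw [h.2 f hf]
  exact ENNReal.ofReal_lt_top

lemma StationaryRandomMeasure.measurable_outside (M : StationaryRandomMeasure d P) {A : Set (E d)}
    {h : E d → ℝ} (hh : IsTestOn Aᶜ h) : Measurable[M.outside A] (M.I h) := by
  rw [measurable_iff_comap_le]
  rw [BorelSpace.measurable_eq (α := ℝ)]
  exact le_iSup₂ (f := fun (h : E d → ℝ) (_ : IsTestOn Aᶜ h) =>
    MeasurableSpace.comap (M.I h) (borel ℝ)) h hh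

lemma tendsto_zero_of_sq_le {a : ℕ → ℝ≥0∞} {C : ℝ≥0∞} (hC : C ≠ ⊤)
    (h : ∀ n, a n ^ 2 ≤ C * ENNReal.ofReal (1 / ((n : ℝ) + 1))) : Tendsto a atTop (𝓝 0) := by
  have h2 : Tendsto (fun n : ℕ => C * ENNReal.ofReal (1 / ((n : ℝ) + 1))) atTop (𝓝 0) := by
    simpa using ENNReal.Tendsto.const_mul
      (ENNReal.tendsto_ofReal (tendsto_one_div_add_atTop_nhds_zero_nat (𝕜 := ℝ))) (.inr hC)
  have h3 : Tendsto (fun n => a n ^ 2) atTop (𝓝 0) :=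
    tendsto_of_tendsto_of_tendsto_of_le_of_le tendsto_const_nhds h2 (fun _ => zero_le) h
  have h4 := h3.ennrpow_const (1 / 2)
  rw [ENNReal.zero_rpow_of_pos (by norm_num)] at h4
  refine h4.congr fun n => ?_
  rw [← ENNReal.rpow_natCast, ← ENNReal.rpow_mul]
  norm_num

/-- Linear rigidity of the indicator implies mass rigidity. -/
lemma StationaryRandomMeasure.LinearlyRigid.massRigid [IsProbabilityMeasure P]
    {M : StationaryRandomMeasure d P} {A : Set (E d)} (hA : MeasurableSet A)
    (hAb : Bornology.IsBounded A) (hr : M.LinearlyRigid A (A.indicator fun _ => 1)) :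
    M.MassRigid A := by
  have hγ := isTest_indicator_one hA hAb
  set X := M.I (A.indicator fun _ => 1)
  choose h hh hvar using fun n : ℕ => hr (1 / ((n : ℝ) + 1)) Nat.one_div_pos_of_nat
  have hX : MemLp X 2 P := M.memLp _ hγ
  have hD : ∀ n, MemLp (fun ω => X ω - M.I (h n) ω) 2 P := fun n => hX.sub (M.memLp _ (hh n).1)
  -- The variance only controls centred differences; adding constants restores `L²` convergence and
  -- keeps measurability outside `A`.
  set c : ℕ → ℝ := fun n => ∫ ω, X ω - M.I (h n) ω ∂P
  set g : ℕ → Ω → ℝ := fun n ω => M.I (h n) ω + c n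
  have hg : ∀ n, MemLp (g n) 2 P := fun n => (M.memLp _ (hh n).1).add (memLp_const _)
  have hL2 : Tendsto (fun n => eLpNorm (g n - X) 2 P) atTop (𝓝 0) := by
    have h1 : ∀ n, eLpNorm (g n - X) 2 P ^ 2 ≤ ENNReal.ofReal (1 / ((n : ℝ) + 1)) := by
      intro n
      rw [sq_eLpNorm_two]
      refine le_trans (le_of_eq ?_) (ENNReal.ofReal_le_ofReal (hvar n).le)
      rw [(hD n).ofReal_variance_eq, evariance_eq_lintegral_ofReal]
      refine lintegral_congr fun ω => ?_
      rw [← ofReal_norm, ← ENNReal.ofReal_pow (norm_nonneg _), Real.norm_eq_abs, sq_abs]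
      congr 1
      simp only [g, c, Pi.sub_apply]
      ring
    exact tendsto_zero_of_sq_le ENNReal.one_ne_top fun n => by rw [one_mul]; exact h1 n
  obtain ⟨ns, -, hns⟩ := (tendstoInMeasure_of_tendsto_eLpNorm (by norm_num)
    (fun n => (hg n).1) hX.1 hL2).exists_seq_tendsto_ae
  -- The limsup is defined for every `ω` and measurable for the outside σ-algebra itself, with no
  -- completion.
  refine ⟨fun ω => limsup (fun n => g (ns n) ω) atTop, ?_, ?_⟩
  · exact Measurable.limsup fun n => (M.measurable_outside (hh (ns n))).add_const _
  · filter_upwards [hns] with ω hω using hω.limsup_eq.symm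

/-- An atom at the origin is singular, so the density is unchanged, yet it adds `|f̂(0)|² = (∫ f)²`
to the spectral integral: approximation then controls means together with variances. -/
lemma isSpectralDensity_add_dirac {S : Measure (E 2)} {s : E 2 → ℝ} (hs : IsSpectralDensity S s) :
    IsSpectralDensity (S + Measure.dirac 0) s := by
  obtain ⟨h1, h2, ν, hν, rfl⟩ := hs
  refine ⟨h1, h2, ν + Measure.dirac 0, ?_, add_assoc _ _ _⟩
  refine Measure.MutuallySingular.add_left hν ?_
  exact ⟨{0}ᶜ, (measurableSet_singleton _).compl, by simp, by simp⟩

/-- The `L²` norm of a linear statistic of a random measure with a mean intensity. -/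
lemma StationaryRandomMeasure.sq_eLpNorm_eq [IsProbabilityMeasure P]
    {M : StationaryRandomMeasure d P} {l : ℝ} (hl : M.HasMeanIntensity l) {S : Measure (E d)}
    (hS : M.IsSpectralMeasure S) {f : E d → ℝ} (hf : IsTest f) :
    eLpNorm (M.I f) 2 P ^ 2 =
      ∫⁻ u, ‖fourierHat f u‖ₑ ^ 2 ∂S + ENNReal.ofReal (l ^ 2) * ‖fourierHat f 0‖ₑ ^ 2 := by
  have hm := M.memLp f hf
  have h1 := variance_eq_sub hm
  rw [hl f hf] at h1
  rw [hS.2 f hf, fourierHat_zero, sq_eLpNorm_two, ← ofReal_norm, Complex.norm_real,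
    ← ENNReal.ofReal_pow (norm_nonneg _), ← ENNReal.ofReal_mul (by positivity),
    ← ENNReal.ofReal_add (variance_nonneg _ _) (by positivity), Real.norm_eq_abs, sq_abs, h1]
  have h2 : ∫⁻ ω, ‖M.I f ω‖ₑ ^ 2 ∂P = ENNReal.ofReal (∫ ω, (M.I f ω) ^ 2 ∂P) := by
    rw [ofReal_integral_eq_lintegral_ofReal hm.integrable_sq (.of_forall fun ω => sq_nonneg _)]
    refine lintegral_congr fun ω => ?_
    rw [← ofReal_norm, ← ENNReal.ofReal_pow (norm_nonneg _), Real.norm_eq_abs, sq_abs]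
  rw [h2]
  congr 1
  simp only [Pi.pow_apply]
  ring

end RandomMeasure

/-! ### Linear rigidity from a zero line -/

section FirstPart

variable {Ω : Type*} [MeasurableSpace Ω] {P : Measure Ω}
  {M : StationaryRandomMeasure 2 P} {S : Measure (E 2)} {s : E 2 → ℝ}

lemma linearlyRigid_of_zero_line (hS : M.IsSpectralMeasure S) (hs : IsSpectralDensity S s)
    (hline : ∀ᶠ u in 𝓝 (!₂[1, 0] : E 2), s u = u 1 ^ 2) {A : Set (E 2)} (hA : MeasurableSet A)
    (hAb : Bornology.IsBounded A) : M.LinearlyRigid A (A.indicator fun _ => 1) := by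
  intro ε hε
  have hγ := isTest_indicator_one hA hAb
  obtain ⟨h, hh, hlt⟩ := exists_test_lintegral_lt hS.hatFinite hS.1 hs hline hA hAb
    (ε := ENNReal.ofReal ε) (by simpa using hε)
  refine ⟨h, hh, ?_⟩
  rw [M.variance_sub hγ hh.1]
  rw [hS.2 _ (hγ.sub hh.1)] at hlt
  exact (ENNReal.ofReal_lt_ofReal_iff hε).1 hlt

lemma isLinearLimit_of_zero_line [IsProbabilityMeasure P] (hS : M.IsSpectralMeasure S) (hs : IsSpectralDensity S s)
    (hline : ∀ᶠ u in 𝓝 (!₂[1, 0] : E 2), s u = u 1 ^ 2) {l : ℝ} (hl : M.HasMeanIntensity l)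
    {A : Set (E 2)} (hA : MeasurableSet A) (hAb : Bornology.IsBounded A) :
    M.IsLinearLimit A (A.indicator fun _ => 1) := by
  have hγ := isTest_indicator_one hA hAb
  set γ : E 2 → ℝ := A.indicator fun _ => 1
  set S' := S + Measure.dirac (0 : E 2)
  have hmeas : ∀ f : E 2 → ℝ, IsTest f → Measurable fun u => ‖fourierHat f u‖ₑ ^ 2 := fun f hf =>
    (continuous_hat hf.ofReal.integrable).enorm.measurable.pow_const 2
  have hS' : HatFinite S' := by
    intro f hf
    rw [lintegral_add_measure, lintegral_dirac' _ (hmeas f hf)]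
    exact ENNReal.add_lt_top.2 ⟨hS.hatFinite f hf, by simp⟩
  have heven : S'.map (fun u => -u) = S' := by
    rw [Measure.map_add _ _ measurable_neg, hS.1, Measure.map_dirac' measurable_neg, neg_zero]
  have key : ∀ n : ℕ, ∃ h, IsTestOn Aᶜ h ∧
      eLpNorm (fun ω => M.I γ ω - M.I h ω) 2 P ^ 2 ≤
        (1 + ENNReal.ofReal (l ^ 2)) * ENNReal.ofReal (1 / ((n : ℝ) + 1)) := by
    intro n
    obtain ⟨h, hh, hlt⟩ := exists_test_lintegral_lt hS' heven (isSpectralDensity_add_dirac hs)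
      hline hA hAb (ε := ENNReal.ofReal (1 / ((n : ℝ) + 1)))
      (by simpa using Nat.cast_add_one_pos n)
    have hf := hγ.sub hh.1
    refine ⟨h, hh, ?_⟩
    rw [← eLpNorm_congr_ae (M.ae_sub hγ hh.1), M.sq_eLpNorm_eq hl hS hf]
    rw [lintegral_add_measure, lintegral_dirac' _ (hmeas _ hf)] at hlt
    rw [add_mul, one_mul]
    exact add_le_add (le_self_add.trans hlt.le) (mul_le_mul_right (le_add_self.trans hlt.le) _)
  choose h hh hle using key
  have hL2 : Tendsto (fun n => eLpNorm (fun ω => M.I γ ω - M.I (h n) ω) 2 P) atTop (𝓝 0) :=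
    tendsto_zero_of_sq_le (by simp) hle
  have hL2' : Tendsto (fun n => eLpNorm (M.I (h n) - M.I γ) 2 P) atTop (𝓝 0) :=
    hL2.congr fun n => eLpNorm_sub_comm _ _ _ _
  obtain ⟨ns, hns, hlim⟩ := (tendstoInMeasure_of_tendsto_eLpNorm (by norm_num)
    (fun n => (M.memLp _ (hh n).1).1) (M.memLp _ hγ).1 hL2').exists_seq_tendsto_ae
  exact ⟨fun n => h (ns n), fun n => hh (ns n), hlim, hL2.comp hns.tendsto_atTop⟩

end FirstPart
end SpectralRigidity
end

/-! ### Random waves with a prescribed finite spectral measure -/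

noncomputable section
namespace SpectralRigidity
open scoped FourierTransform ENNReal NNReal ComplexConjugate

section RandomWave

variable {d : ℕ}

/-- The law of a fair coin. -/
def coin : Measure Bool := (2⁻¹ : ℝ≥0∞) • (Measure.dirac true + Measure.dirac false)

/-- The random sign attached to a coin flip. -/
def coinSign (b : Bool) : ℝ := if b then 1 else -1

instance : IsProbabilityMeasure coin := ⟨by
  simp only [coin, Measure.smul_apply, Measure.add_apply, measure_univ, smul_eq_mul]
  rw [one_add_one_eq_two, ENNReal.inv_mul_cancel (by norm_num) (by norm_num)]⟩

lemma integral_coin (g : Bool → ℝ) : ∫ b, g b ∂coin = (g true + g false) / 2 := by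
  rw [coin, integral_smul_measure, integral_add_measure (.of_finite) (.of_finite), integral_dirac,
    integral_dirac]
  simp
  ring

/-- The normalization of a measure to a probability measure. -/
def normalized (S : Measure (E d)) : Measure (E d) := (S Set.univ)⁻¹ • S

instance (S : Measure (E d)) [IsFiniteMeasure S] [NeZero S] :
    IsProbabilityMeasure (normalized S) := isProbabilityMeasureSMul

/-- The sum of the real and imaginary parts of the Fourier transform. -/
def hartley (f : E d → ℝ) (u : E d) : ℝ := (fourierHat f u).re + (fourierHat f u).im

/-- The linear statistics of the random measure with density `1 + c ε (cos ⟨u, x⟩ - sin ⟨u, x⟩)`,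
for a random frequency `u` and an independent random sign `ε`. -/
def waveStatistic (c : ℝ) (f : E d → ℝ) (p : E d × Bool) : ℝ :=
  (∫ x, f x) + c * (hartley f p.1 * coinSign p.2)

lemma continuous_hartley {f : E d → ℝ} (hf : IsTest f) : Continuous (hartley f) := by
  have h : Continuous (fourierHat f) := continuous_hat hf.ofReal.integrable
  exact (Complex.continuous_re.comp h).add (Complex.continuous_im.comp h)

lemma norm_fourierHat_le (f : E d → ℝ) (u : E d) : ‖fourierHat f u‖ ≤ ∫ t, |f t| := by
  have := norm_hat_le (fun t => (f t : ℂ)) u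
  simp only [Complex.norm_real, Real.norm_eq_abs] at this
  exact this

lemma abs_hartley_le (f : E d → ℝ) (u : E d) : |hartley f u| ≤ 2 * ∫ t, |f t| := by
  have h := norm_fourierHat_le f u
  have h1 := (Complex.abs_re_le_norm (fourierHat f u)).trans h
  have h2 := (Complex.abs_im_le_norm (fourierHat f u)).trans h
  have := abs_add_le (fourierHat f u).re (fourierHat f u).im
  unfold hartley
  linarith

lemma measurable_coinSign : Measurable coinSign := measurable_of_finite _

lemma measurable_waveStatistic (c : ℝ) {f : E d → ℝ} (hf : IsTest f) :
    Measurable (waveStatistic c f) :=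
  measurable_const.add (measurable_const.mul
    (((continuous_hartley hf).measurable.comp measurable_fst).mul
      (measurable_coinSign.comp measurable_snd)))

lemma abs_coinSign (b : Bool) : |coinSign b| = 1 := by cases b <;> simp [coinSign]

variable {S : Measure (E d)} [IsFiniteMeasure S]

lemma memLp_waveStatistic [NeZero S] (c : ℝ) {f : E d → ℝ} (hf : IsTest f) (q : ℝ≥0∞) :
    MemLp (waveStatistic c f) q ((normalized S).prod coin) := by
  refine MemLp.of_bound (measurable_waveStatistic c hf).aestronglyMeasurable
    (|∫ x, f x| + |c| * (2 * ∫ t, |f t|)) (.of_forall fun p => ?_)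
  rw [Real.norm_eq_abs]
  refine (abs_add_le _ _).trans ?_
  rw [abs_mul, abs_mul, abs_coinSign, mul_one]
  gcongr
  exact abs_hartley_le f _

lemma integral_waveStatistic [NeZero S] (c : ℝ) {f : E d → ℝ} (hf : IsTest f) :
    ∫ p, waveStatistic c f p ∂((normalized S).prod coin) = ∫ x, f x := by
  have h0 : ∫ b, coinSign b ∂coin = 0 := by rw [integral_coin]; simp [coinSign]
  have h1 := (memLp_one_iff_integrable.1 (memLp_waveStatistic (S := S) c hf 1))
  have h2 : Integrable (fun p : E d × Bool => c * (hartley f p.1 * coinSign p.2))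
      ((normalized S).prod coin) := by
    refine (h1.sub (integrable_const (∫ x, f x))).congr (.of_forall fun p => ?_)
    simp [waveStatistic]
  unfold waveStatistic
  rw [integral_add (integrable_const _) h2, integral_const_mul, integral_prod_mul, h0]
  simp

lemma fourierHat_neg (f : E d → ℝ) (u : E d) : fourierHat f (-u) = conj (fourierHat f u) :=
  hat_neg_of_real f u

/-- The cross term `2 Re f̂ Im f̂` is odd because `f̂(-u)` is the conjugate of `f̂(u)`, so it
integrates to zero against an even measure. This is why the wave needs no random phase. -/
lemma integral_sq_hartley (heven : S.map (fun u => -u) = S) {f : E d → ℝ} (hf : IsTest f) :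
    ∫ u, hartley f u ^ 2 ∂S = ∫ u, ‖fourierHat f u‖ ^ 2 ∂S := by
  have hc : Continuous (fourierHat f) := continuous_hat hf.ofReal.integrable
  have hre : Continuous fun u => (fourierHat f u).re := Complex.continuous_re.comp hc
  have him : Continuous fun u => (fourierHat f u).im := Complex.continuous_im.comp hc
  set B := ∫ t, |f t|
  have hB : ∀ u, ‖fourierHat f u‖ ≤ B := norm_fourierHat_le f
  have hB0 : 0 ≤ B := (norm_nonneg _).trans (hB 0)
  have hi1 : Integrable (fun u => ‖fourierHat f u‖ ^ 2) S :=
    .of_bound (hc.norm.pow 2).aestronglyMeasurable (B ^ 2) (.of_forall fun u => by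
      rw [norm_pow, norm_norm]; exact pow_le_pow_left₀ (norm_nonneg _) (hB u) 2)
  have hi2 : Integrable (fun u => 2 * ((fourierHat f u).re * (fourierHat f u).im)) S := by
    refine Integrable.const_mul (.of_bound (hre.mul him).aestronglyMeasurable (B * B)
      (.of_forall fun u => ?_)) 2
    rw [Pi.mul_apply, norm_mul]
    exact mul_le_mul ((Complex.abs_re_le_norm _).trans (hB u))
      ((Complex.abs_im_le_norm _).trans (hB u)) (norm_nonneg _) hB0
  have hodd : ∫ u, 2 * ((fourierHat f u).re * (fourierHat f u).im) ∂S = 0 := by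
    have h1 : ∫ u, 2 * ((fourierHat f u).re * (fourierHat f u).im) ∂S =
        ∫ u, -(2 * ((fourierHat f u).re * (fourierHat f u).im)) ∂S := by
      conv_lhs => rw [← heven]
      rw [integral_map measurable_neg.aemeasurable
        (by fun_prop : Continuous fun u =>
          2 * ((fourierHat f u).re * (fourierHat f u).im)).aestronglyMeasurable]
      refine integral_congr_ae (.of_forall fun u => ?_)
      simp only [fourierHat_neg, Complex.conj_re, Complex.conj_im]
      ring
    rw [integral_neg] at h1
    linarith
  rw [← add_zero (∫ u, ‖fourierHat f u‖ ^ 2 ∂S), ← hodd, ← integral_add hi1 hi2]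
  refine integral_congr_ae (.of_forall fun u => ?_)
  simp only [hartley, ← Complex.normSq_eq_norm_sq, Complex.normSq_apply]
  ring

variable [NeZero S]

/-- The sign squares to one, and the amplitude `√S(ℝ^d)` undoes the normalization of the frequency
law. -/
lemma variance_waveStatistic (heven : S.map (fun u => -u) = S) {f : E d → ℝ} (hf : IsTest f) :
    Var[waveStatistic (Real.sqrt (S.real Set.univ)) f; (normalized S).prod coin] =
      ∫ u, ‖fourierHat f u‖ ^ 2 ∂S := by
  have hpos : 0 < S.real Set.univ := by
    rw [measureReal_def]
    exact ENNReal.toReal_pos (by simpa using NeZero.ne S) (measure_ne_top _ _)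
  rw [variance_eq_integral (measurable_waveStatistic _ hf).aemeasurable,
    integral_waveStatistic _ hf]
  have h1 : ∀ p : E d × Bool,
      (waveStatistic (Real.sqrt (S.real Set.univ)) f p - ∫ x, f x) ^ 2 =
      S.real Set.univ * (hartley f p.1 ^ 2 * 1) := by
    intro p
    have h2 : coinSign p.2 ^ 2 = 1 := by rw [← sq_abs, abs_coinSign, one_pow]
    rw [waveStatistic, add_sub_cancel_left, mul_pow, mul_pow, h2, Real.sq_sqrt hpos.le]
  simp only [h1]
  rw [integral_const_mul, integral_prod_mul (fun u => hartley f u ^ 2) (fun _ : Bool => (1 : ℝ)),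
    normalized, integral_smul_measure, integral_sq_hartley heven hf]
  simp only [ENNReal.toReal_inv, integral_const, probReal_univ, smul_eq_mul, mul_one]
  rw [← measureReal_def, ← mul_assoc, mul_inv_cancel₀ hpos.ne', one_mul]

/-- Nonnegativity makes `g` dominate the partial sums. -/
lemma tendsto_sum_hat {f : ℕ → E d → ℝ} {g : E d → ℝ} (hf : ∀ n, IsTest (f n)) (hg : IsTest g)
    (hpos : ∀ n x, 0 ≤ f n x) (hsum : ∀ x, HasSum (fun n => f n x) (g x)) (u : E d) :
    Tendsto (fun N => ∑ n ∈ Finset.range N, fourierHat (f n) u) atTop (𝓝 (fourierHat g u)) := by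
  have h1 : ∀ N, ∑ n ∈ Finset.range N, fourierHat (f n) u =
      ∫ t, Complex.exp (-(Complex.I * ((inner ℝ u t : ℝ) : ℂ))) *
        ((∑ n ∈ Finset.range N, f n t : ℝ) : ℂ) := by
    intro N
    unfold fourierHat
    rw [← integral_finsetSum _ fun n _ => integrable_exp_mul (hf n).ofReal.integrable u]
    simp only [Complex.ofReal_sum, Finset.mul_sum]
  simp only [h1]
  refine tendsto_integral_of_dominated_convergence g (fun N => ?_) hg.integrable
    (fun N => .of_forall fun t => ?_) (.of_forall fun t => ?_)
  · refine (Continuous.aestronglyMeasurable (by fun_prop)).mul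
      (Complex.measurable_ofReal.comp ?_).aestronglyMeasurable
    exact Finset.measurable_sum _ fun n _ => (hf n).1
  · rw [norm_mul, norm_exp_neg_I_mul, one_mul, Complex.norm_real,
      Real.norm_of_nonneg (Finset.sum_nonneg fun n _ => hpos n t)]
    exact sum_le_hasSum _ (fun n _ => hpos n t) (hsum t)
  · exact ((Complex.continuous_ofReal.tendsto _).comp (hsum t).tendsto_sum_nat).const_mul _

lemma waveStatistic_eq (c : ℝ) (f : E d → ℝ) (p : E d × Bool) : waveStatistic c f p =
    (fourierHat f 0).re +
      c * (((fourierHat f p.1).re + (fourierHat f p.1).im) * coinSign p.2) := by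
  rw [fourierHat_zero, Complex.ofReal_re]; rfl

lemma fourierHat_linearComb {f g : E d → ℝ} (hf : IsTest f) (hg : IsTest g) (a b : ℝ) (u : E d) :
    fourierHat (fun x => a * f x + b * g x) u = a * fourierHat f u + b * fourierHat g u := by
  have h := hat_add (hf.ofReal.smul a).integrable (hg.ofReal.smul b).integrable u
  rw [hat_smul, hat_smul] at h
  simp only [← Complex.ofReal_mul, ← Complex.ofReal_add] at h
  exact h

lemma norm_fourierHat_translate (f : E d → ℝ) (y u : E d) :
    ‖fourierHat (fun x => f (x - y)) u‖ = ‖fourierHat f u‖ := by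
  have := hat_translate (fun x => (f x : ℂ)) y u
  change ‖hat (fun x => ((f (x - y) : ℝ) : ℂ)) u‖ = _
  rw [this, norm_mul, norm_exp_neg_I_mul, one_mul]
  rfl

lemma IsTest.translate {f : E d → ℝ} (hf : IsTest f) (y : E d) : IsTest fun x => f (x - y) := by
  simpa using (hf.ofReal.translate y).re

/-- The stationary random measure of mean intensity one with the finite even spectral measure `S`,
given by waves of random frequency. -/
def randomWave (S : Measure (E d)) [IsFiniteMeasure S] [NeZero S]
    (heven : S.map (fun u => -u) = S) :
    StationaryRandomMeasure d ((normalized S).prod coin) where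
  I := waveStatistic (Real.sqrt (S.real Set.univ))
  memLp _ hf := memLp_waveStatistic _ hf 2
  linear a b f g hf hg := .of_forall fun p => by
    simp only [waveStatistic_eq, fourierHat_linearComb hf hg, Complex.add_re, Complex.add_im,
      Complex.re_ofReal_mul, Complex.im_ofReal_mul]
    ring
  sigmaAdditive f g hf hg hpos hsum := .of_forall fun p => by
    have h0 := (Complex.continuous_re.tendsto _).comp (tendsto_sum_hat hf hg hpos hsum 0)
    have h1 := (Complex.continuous_re.tendsto _).comp (tendsto_sum_hat hf hg hpos hsum p.1)
    have h2 := (Complex.continuous_im.tendsto _).comp (tendsto_sum_hat hf hg hpos hsum p.1)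
    have h3 := h0.add (((h1.add h2).mul_const (coinSign p.2)).const_mul
      (Real.sqrt (S.real Set.univ)))
    simp only [waveStatistic_eq]
    refine h3.congr fun N => ?_
    simp only [Function.comp_apply, Complex.re_sum, Complex.im_sum, Finset.sum_add_distrib]
    rw [← Finset.sum_add_distrib, Finset.sum_mul, Finset.mul_sum]
  variance_translate f y hf := by
    rw [variance_waveStatistic heven hf, variance_waveStatistic heven (hf.translate y)]
    simp only [norm_fourierHat_translate]

lemma variance_randomWave (heven : S.map (fun u => -u) = S) {f : E d → ℝ} (hf : IsTest f) :
    Var[(randomWave S heven).I f; (normalized S).prod coin] = ∫ u, ‖fourierHat f u‖ ^ 2 ∂S :=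
  variance_waveStatistic heven hf

lemma hasMeanIntensity_randomWave (heven : S.map (fun u => -u) = S) :
    (randomWave S heven).HasMeanIntensity 1 := fun f hf => by
  rw [one_mul]; exact integral_waveStatistic _ hf

lemma isSpectralMeasure_randomWave (heven : S.map (fun u => -u) = S) :
    (randomWave S heven).IsSpectralMeasure S := by
  refine ⟨heven, fun f hf => ?_⟩
  have hc : Continuous (fourierHat f) := continuous_hat hf.ofReal.integrable
  have hi : Integrable (fun u => ‖fourierHat f u‖ ^ 2) S :=
    .of_bound (hc.norm.pow 2).aestronglyMeasurable ((∫ t, |f t|) ^ 2) (.of_forall fun u => by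
      rw [norm_pow, norm_norm]
      exact pow_le_pow_left₀ (norm_nonneg _) (norm_fourierHat_le f u) 2)
  rw [variance_randomWave heven hf,
    ofReal_integral_eq_lintegral_ofReal hi (.of_forall fun u => by positivity)]
  refine lintegral_congr fun u => ?_
  rw [← ofReal_norm, ← ENNReal.ofReal_pow (norm_nonneg _)]

end RandomWave

/-! ### The spectral density of the example -/

section Density

/-- The spectral density of the example: one near the origin, `u₂²` around `(1, 0)`. -/
def waveDensity (u : E 2) : ℝ :=
  if ‖u‖ < 1 / 2 then 1 else if ‖u‖ < 2 then u 1 ^ 2 else u 1 ^ 2 / (1 + ‖u‖ ^ 2) ^ 3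

lemma sq_coord_le (u : E 2) : u 1 ^ 2 ≤ ‖u‖ ^ 2 := by
  rw [EuclideanSpace.norm_sq_eq, Fin.sum_univ_two]
  simp only [Real.norm_eq_abs, sq_abs]
  nlinarith [sq_nonneg (u 0)]

lemma waveDensity_nonneg (u : E 2) : 0 ≤ waveDensity u := by
  unfold waveDensity; split_ifs <;> positivity

lemma measurable_waveDensity : Measurable waveDensity := by
  have h1 : Measurable fun u : E 2 => u 1 := by fun_prop
  refine Measurable.ite (measurableSet_lt measurable_norm measurable_const) measurable_const
    (Measurable.ite (measurableSet_lt measurable_norm measurable_const) (h1.pow_const 2) ?_)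
  exact (h1.pow_const 2).div (((measurable_norm.pow_const 2).const_add 1).pow_const 3)

lemma waveDensity_neg (u : E 2) : waveDensity (-u) = waveDensity u := by
  simp [waveDensity]

/-- This makes `u₂² / s` of polynomial growth, the input of the Cauchy–Schwarz bound; rapid decay of
the bump's transform absorbs the weight. -/
lemma sq_coord_le_waveDensity_mul (u : E 2) : u 1 ^ 2 ≤ waveDensity u * (1 + ‖u‖ ^ 2) ^ 3 := by
  have h1 : (1 : ℝ) ≤ (1 + ‖u‖ ^ 2) ^ 3 := one_le_pow₀ (by nlinarith [sq_nonneg ‖u‖])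
  have h2 := sq_coord_le u
  unfold waveDensity
  split_ifs with h3 h4
  · nlinarith [norm_nonneg u]
  · nlinarith [sq_nonneg (u 1)]
  · rw [div_mul_cancel₀ _ (by positivity)]

/-- The density is dominated by `100 (1+|u|²)^{-2}`, which is integrable in the plane. The constant
comes from the middle region `|u| < 2`, where `u₂² (1+|u|²)² ≤ 4 · 25`. -/
lemma integrable_waveDensity : Integrable waveDensity := by
  have h := (integrable_rpow_neg_one_add_norm_sq (E := E 2) (μ := volume) (r := 4)
    (by rw [finrank_euclideanSpace_fin]; norm_num)).const_mul 100
  refine h.mono' measurable_waveDensity.aestronglyMeasurable (.of_forall fun u => ?_)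
  rw [Real.norm_of_nonneg (waveDensity_nonneg u),
    show (-4 / 2 : ℝ) = -(2 : ℕ) by norm_num, Real.rpow_neg (by positivity), Real.rpow_natCast,
    ← div_eq_mul_inv, le_div_iff₀ (by positivity)]
  have h2 := sq_coord_le u
  have h0 := norm_nonneg u
  unfold waveDensity
  split_ifs with h3 h4
  · have : ‖u‖ ^ 2 ≤ 1 := by nlinarith
    nlinarith [sq_nonneg ‖u‖]
  · have h5 : ‖u‖ ^ 2 ≤ 4 := by nlinarith
    have h6 : (1 + ‖u‖ ^ 2) ^ 2 ≤ 25 := by nlinarith [sq_nonneg ‖u‖]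
    nlinarith [sq_nonneg (u 1), sq_nonneg (1 + ‖u‖ ^ 2)]
  · have h7 : (0 : ℝ) < 1 + ‖u‖ ^ 2 := by positivity
    rw [pow_succ _ 2, div_mul_eq_mul_div, div_le_iff₀ (by positivity)]
    have h8 : (0 : ℝ) ≤ (1 + ‖u‖ ^ 2) ^ 2 := by positivity
    nlinarith [mul_le_mul_of_nonneg_right h2 h8, mul_nonneg h8 (sq_nonneg ‖u‖)]

/-- The spectral measure of the example. -/
def waveSpectrum : Measure (E 2) := volume.withDensity fun u => ENNReal.ofReal (waveDensity u)

instance : IsFiniteMeasure waveSpectrum :=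
  isFiniteMeasure_withDensity_ofReal integrable_waveDensity.2

instance : NeZero waveSpectrum := ⟨fun h => by
  have h1 : waveSpectrum (Metric.ball 0 (1 / 2)) = volume (Metric.ball (0 : E 2) (1 / 2)) := by
    rw [waveSpectrum, withDensity_apply _ Metric.isOpen_ball.measurableSet, ← setLIntegral_one]
    refine setLIntegral_congr_fun Metric.isOpen_ball.measurableSet fun u hu => ?_
    simp only [waveDensity, if_pos (mem_ball_zero_iff.1 hu), ENNReal.ofReal_one]
  rw [h] at h1
  exact (Metric.measure_ball_pos volume (0 : E 2) (by norm_num : (0 : ℝ) < 1 / 2)).ne h1⟩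

lemma map_neg_waveSpectrum : waveSpectrum.map (fun u => -u) = waveSpectrum := by
  refine Measure.ext fun B hB => ?_
  rw [Measure.map_apply measurable_neg hB, waveSpectrum, withDensity_apply _ hB,
    withDensity_apply _ (measurable_neg hB),
    ← (Measure.measurePreserving_neg (volume : Measure (E 2))).setLIntegral_comp_preimage hB
      measurable_waveDensity.ennreal_ofReal]
  simp only [waveDensity_neg]

lemma isSpectralDensity_waveSpectrum : IsSpectralDensity waveSpectrum waveDensity :=
  ⟨measurable_waveDensity, waveDensity_nonneg, 0, Measure.MutuallySingular.zero_left,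
    (add_zero _).symm⟩

lemma waveDensity_near_one : ∀ᶠ u in 𝓝 (!₂[1, 0] : E 2), waveDensity u = u 1 ^ 2 := by
  have hn : ‖(!₂[1, 0] : E 2)‖ = 1 := by
    rw [EuclideanSpace.norm_eq, Fin.sum_univ_two]; simp
  have h1 := continuous_norm.continuousAt.eventually
    (Ioo_mem_nhds (show (1 / 2 : ℝ) < ‖(!₂[1, 0] : E 2)‖ by rw [hn]; norm_num)
      (show ‖(!₂[1, 0] : E 2)‖ < 2 by rw [hn]; norm_num))
  filter_upwards [h1] with u hu
  rw [waveDensity, if_neg (not_lt.2 hu.1.le), if_pos hu.2]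

lemma waveDensity_near_zero : ∀ᶠ u in 𝓝 (0 : E 2), waveDensity u = 1 := by
  filter_upwards [Metric.ball_mem_nhds (0 : E 2) (by norm_num : (0 : ℝ) < 1 / 2)] with u hu
  rw [waveDensity, if_pos (mem_ball_zero_iff.1 hu)]

lemma integral_waveSpectrum (g : E 2 → ℝ) :
    ∫ u, g u ∂waveSpectrum = ∫ u, g u * waveDensity u := by
  rw [waveSpectrum, integral_withDensity_eq_integral_toReal_smul
    measurable_waveDensity.ennreal_ofReal (.of_forall fun u => ENNReal.ofReal_lt_top)]
  simp only [ENNReal.toReal_ofReal (waveDensity_nonneg _), smul_eq_mul, mul_comm]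

end Density
end SpectralRigidity
end

/-! ### Failure of maximal rigidity -/

noncomputable section
namespace SpectralRigidity
open scoped FourierTransform ComplexConjugate LineDeriv SchwartzMap ContDiff

section NonRigid

/-- A real smooth bump supported in `A`, as a Schwartz function. -/
def bumpSchwartz {x : E 2} (b : ContDiffBump x) : 𝓢(E 2, ℂ) :=
  (b.hasCompactSupport.comp_left (g := fun r : ℝ => (r : ℂ)) rfl).toSchwartzMap
    (Complex.ofRealCLM.contDiff.comp b.contDiff)

/-- The vertical derivative of a bump. -/
def bumpDeriv {x : E 2} (b : ContDiffBump x) (y : E 2) : ℝ := fderiv ℝ b y !₂[0, 1]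

variable {x : E 2} (b : ContDiffBump x)

lemma lineDeriv_bumpSchwartz (y : E 2) :
    (∂_{(!₂[0, 1] : E 2)} (bumpSchwartz b)) y = (bumpDeriv b y : ℂ) := by
  rw [SchwartzMap.lineDerivOp_apply_eq_fderiv]
  have h : (bumpSchwartz b : E 2 → ℂ) = Complex.ofRealCLM ∘ b := rfl
  have hb : DifferentiableAt ℝ b y :=
    ((b.contDiff (n := 1)).differentiable (by norm_num)).differentiableAt
  rw [h, fderiv_comp y Complex.ofRealCLM.differentiableAt hb]
  simp [bumpDeriv]

lemma continuous_bumpDeriv : Continuous (bumpDeriv b) :=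
  ((b.contDiff (n := 1)).continuous_fderiv (by norm_num)).clm_apply continuous_const

lemma support_bumpDeriv_subset : Function.support (bumpDeriv b) ⊆ Metric.closedBall x b.rOut := by
  rw [← b.tsupport_eq]
  intro y hy
  refine support_fderiv_subset ℝ fun h => hy ?_
  simp [bumpDeriv, h]

lemma hasCompactSupport_bumpDeriv : HasCompactSupport (bumpDeriv b) :=
  HasCompactSupport.of_support_subset_isCompact (isCompact_closedBall _ _)
    (support_bumpDeriv_subset b)

lemma isTest_bumpDeriv : IsTest (bumpDeriv b) :=
  ⟨(continuous_bumpDeriv b).measurable,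
    (hasCompactSupport_bumpDeriv b).exists_bound_of_continuous (continuous_bumpDeriv b),
    Metric.isBounded_closedBall.subset (support_bumpDeriv_subset b)⟩

/-- Otherwise `b` is constant on the vertical line through its centre, although it is `1` at the
centre and `0` at distance `rOut`. -/
lemma exists_bumpDeriv_ne_zero : ∃ y, bumpDeriv b y ≠ 0 := by
  by_contra! h
  have hd : Differentiable ℝ b := (b.contDiff (n := 1)).differentiable (by norm_num)
  set e : E 2 := !₂[0, 1]
  have hline : ∀ t : ℝ, HasDerivAt (fun t : ℝ => b (x + t • e)) 0 t := by
    intro t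
    have h1 : HasDerivAt (fun t : ℝ => x + t • e) e t := by
      simpa using ((hasDerivAt_id t).smul_const e).const_add x
    have h2 := (hd (x + t • e)).hasFDerivAt.comp_hasDerivAt t h1
    rwa [show fderiv ℝ b (x + t • e) e = 0 from h _] at h2
  have hconst := is_const_of_deriv_eq_zero (fun t => (hline t).differentiableAt)
    (fun t => (hline t).deriv) 0 b.rOut
  have he : ‖e‖ = 1 := by
    rw [EuclideanSpace.norm_eq, Fin.sum_univ_two]; simp [e]
  have h0 : b (x + b.rOut • e) = 0 := by
    refine b.zero_of_le_dist ?_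
    simp [dist_eq_norm, norm_smul, he, abs_of_pos b.rOut_pos]
  have h1 : b x = 1 := b.one_of_mem_closedBall (by simp [b.rIn_pos.le])
  simp [h0, h1] at hconst

lemma integral_sq_bumpDeriv_pos : 0 < ∫ y, bumpDeriv b y ^ 2 := by
  obtain ⟨y, hy⟩ := exists_bumpDeriv_ne_zero b
  refine ((continuous_bumpDeriv b).pow 2).integral_pos_of_hasCompactSupport_nonneg_nonzero
    (x := y) ?_ (fun _ => sq_nonneg _) (by simpa using hy)
  exact (hasCompactSupport_bumpDeriv b).comp_left (g := fun r : ℝ => r ^ 2) (by simp)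

/-- Duality between the Fourier transform and the inverse transform of the derivative of a bump. -/
lemma integral_fourier_mul_bump {f : E 2 → ℝ} (hf : IsTest f) :
    ∫ w, 𝓕 (fun y => (f y : ℂ)) w * (𝓕⁻ (∂_{(!₂[0, 1] : E 2)} (bumpSchwartz b)) : 𝓢(E 2, ℂ)) w =
      ((∫ y, f y * bumpDeriv b y : ℝ) : ℂ) := by
  set G : 𝓢(E 2, ℂ) := 𝓕⁻ (∂_{(!₂[0, 1] : E 2)} (bumpSchwartz b))
  have hG : ∀ y, 𝓕 (G : E 2 → ℂ) y = (bumpDeriv b y : ℂ) := fun y => by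
    rw [← SchwartzMap.fourier_coe, FourierTransform.fourier_fourierInv_eq, lineDeriv_bumpSchwartz]
  have h := VectorFourier.integral_fourierIntegral_smul_eq_flip (μ := (volume : Measure (E 2)))
    (ν := (volume : Measure (E 2))) (L := innerₗ (E 2)) (f := fun y => (f y : ℂ))
    (g := (G : E 2 → ℂ)) Real.continuous_fourierChar continuous_inner hf.ofReal.integrable
    G.integrable
  rw [flip_innerₗ] at h
  simp only [smul_eq_mul] at h
  refine Eq.trans h ?_
  rw [← integral_complex_ofReal]
  refine integral_congr_ae (.of_forall fun y => ?_)
  have := hG y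
  simp only [Complex.ofReal_mul, ← this]
  rfl

/-- Differentiation produces the factor `u₂`, with `u = 2πw`, that compensates the zero line of the
density. -/
lemma norm_fourierInv_bump (w : E 2) :
    ‖(𝓕⁻ (∂_{(!₂[0, 1] : E 2)} (bumpSchwartz b)) : 𝓢(E 2, ℂ)) w‖ =
      |((2 * Real.pi) • w) 1| * ‖(𝓕⁻ (bumpSchwartz b) : 𝓢(E 2, ℂ)) w‖ := by
  have ht : (fun w : E 2 => inner ℝ w (!₂[0, 1] : E 2)).HasTemperateGrowth := by fun_prop
  rw [SchwartzMap.fourierInv_lineDerivOp_eq]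
  simp only [smul_apply, SchwartzMap.smulLeftCLM_apply_apply ht, norm_smul, norm_neg,
    norm_mul, Complex.norm_I, PiLp.smul_apply, smul_eq_mul, abs_mul]
  rw [← mul_assoc]
  congr 1
  simp [PiLp.inner_apply, Fin.sum_univ_two]

/-- One factor `‖g w‖` absorbs the expanded polynomial weight by Schwartz decay; the other is
bounded. -/
lemma integrable_weight (g : 𝓢(E 2, ℂ)) :
    Integrable fun w : E 2 => (1 + ‖(2 * Real.pi) • w‖ ^ 2) ^ 3 * ‖g w‖ ^ 2 := by
  set c : ℝ := ‖2 * Real.pi‖ ^ 2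
  have hp := g.integrable_pow_mul (μ := (volume : Measure (E 2)))
  have h1 : Integrable fun w : E 2 => (1 + c * ‖w‖ ^ 2) ^ 3 * ‖g w‖ := by
    have := (((hp 0).add ((hp 2).const_mul (3 * c))).add ((hp 4).const_mul (3 * c ^ 2))).add
      ((hp 6).const_mul (c ^ 3))
    refine this.congr (.of_forall fun w => ?_)
    simp only [Pi.add_apply]
    ring
  obtain ⟨C, hC⟩ := g.decay 0 0
  have h2 := h1.mul_bdd (c := C) (g := fun w => ‖g w‖) g.continuous.norm.aestronglyMeasurable
    (.of_forall fun w => by simpa using hC.2 w)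
  refine h2.congr (.of_forall fun w => ?_)
  simp only [norm_smul, mul_pow, c]
  ring

/-- The rescaling has Jacobian `(2π)^{-2} ≤ 1`, which is simply dropped. -/
lemma integral_sq_hat_scaled (f : E 2 → ℝ) :
    ∫ w : E 2, ‖fourierHat f ((2 * Real.pi) • w)‖ ^ 2 * waveDensity ((2 * Real.pi) • w) ≤
      ∫ u, ‖fourierHat f u‖ ^ 2 ∂waveSpectrum := by
  rw [integral_waveSpectrum, Measure.integral_comp_smul (volume : Measure (E 2))
    (fun u => ‖fourierHat f u‖ ^ 2 * waveDensity u), smul_eq_mul]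
  refine mul_le_of_le_one_left (integral_nonneg fun u => mul_nonneg (by positivity)
    (waveDensity_nonneg u)) ?_
  rw [abs_inv]
  refine inv_le_one_of_one_le₀ ?_
  rw [abs_pow]
  refine one_le_pow₀ ?_
  rw [abs_of_pos (by have := Real.pi_pos; positivity)]
  linarith [Real.pi_gt_three]

/-- A Cauchy–Schwarz lower bound for the variance of statistics that correlate with the derivative of
a bump. -/
lemma sq_integral_le : ∃ C > 0, ∀ f : E 2 → ℝ, IsTest f →
    ∀ t > 0, 2 * |∫ y, f y * bumpDeriv b y| ≤
      t * (∫ u, ‖fourierHat f u‖ ^ 2 ∂waveSpectrum) + t⁻¹ * C := by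
  set g : 𝓢(E 2, ℂ) := 𝓕⁻ (bumpSchwartz b)
  have hw := integrable_weight g
  set D : E 2 → ℝ := fun w => (1 + ‖(2 * Real.pi) • w‖ ^ 2) ^ 3 * ‖g w‖ ^ 2
  have hD0 : 0 ≤ ∫ w, D w := integral_nonneg fun w => by positivity
  -- The added `1` guarantees a positive constant, so that it can be divided by.
  refine ⟨(∫ w, D w) + 1, by positivity, fun f hf t ht => ?_⟩
  set k : E 2 → ℝ := fun w =>
    ‖fourierHat f ((2 * Real.pi) • w)‖ ^ 2 * waveDensity ((2 * Real.pi) • w)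
  have hk : Integrable k := by
    have h1 : Integrable fun w : E 2 => waveDensity ((2 * Real.pi) • w) :=
      integrable_waveDensity.comp_smul (by simp [Real.pi_ne_zero])
    have hc : Continuous (fourierHat f) := continuous_hat hf.ofReal.integrable
    refine h1.bdd_mul (c := (∫ t, |f t|) ^ 2)
      (by fun_prop : Continuous fun w : E 2 => ‖fourierHat f ((2 * Real.pi) • w)‖ ^ 2).aestronglyMeasurable
      (.of_forall fun w => ?_)
    rw [norm_pow, norm_norm]
    exact pow_le_pow_left₀ (norm_nonneg _) (norm_fourierHat_le f _) 2
  have hle : 2 * |∫ y, f y * bumpDeriv b y| ≤ ∫ w, (t * k w + t⁻¹ * D w) := by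
    rw [← Real.norm_eq_abs, ← Complex.norm_real, ← integral_fourier_mul_bump b hf]
    refine (mul_le_mul_of_nonneg_left (norm_integral_le_integral_norm _) zero_le_two).trans ?_
    rw [← integral_const_mul]
    refine integral_mono_of_nonneg (.of_forall fun w => by positivity)
      ((hk.const_mul t).add (hw.const_mul t⁻¹)) (.of_forall fun w => ?_)
    beta_reduce
    rw [norm_mul, norm_fourierInv_bump, fourier_eq_hat]
    change 2 * (‖fourierHat f ((2 * Real.pi) • w)‖ * _) ≤ _
    set v := (2 * Real.pi) • w
    set a := ‖fourierHat f v‖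
    have h1 : |v 1| ≤ Real.sqrt (waveDensity v) * Real.sqrt ((1 + ‖v‖ ^ 2) ^ 3) := by
      rw [← Real.sqrt_mul (waveDensity_nonneg v)]
      exact Real.abs_le_sqrt (sq_coord_le_waveDensity_mul v)
    set p := Real.sqrt (waveDensity v)
    set q := Real.sqrt ((1 + ‖v‖ ^ 2) ^ 3)
    have hp : p ^ 2 = waveDensity v := Real.sq_sqrt (waveDensity_nonneg v)
    have hq : q ^ 2 = (1 + ‖v‖ ^ 2) ^ 3 := Real.sq_sqrt (by positivity)
    have h2 : k w = (a * p) ^ 2 := by rw [mul_pow, hp]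
    have h3 : D w = (q * ‖g w‖) ^ 2 := by rw [mul_pow, hq]
    have h4 : a * (|v 1| * ‖g w‖) ≤ (a * p) * (q * ‖g w‖) := by
      calc a * (|v 1| * ‖g w‖) ≤ a * ((p * q) * ‖g w‖) := by gcongr
        _ = _ := by ring
    rw [h2, h3]
    -- Young's inequality with a free parameter `t` stands in for Cauchy–Schwarz and can be
    -- integrated pointwise.
    have h5 : 2 * ((a * p) * (q * ‖g w‖)) ≤ t * (a * p) ^ 2 + t⁻¹ * (q * ‖g w‖) ^ 2 := by
      have h6 : 0 ≤ t⁻¹ * (t * (a * p) - q * ‖g w‖) ^ 2 := by positivity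
      have h7 : t⁻¹ * (t * (a * p) - q * ‖g w‖) ^ 2 =
          t * (a * p) ^ 2 + t⁻¹ * (q * ‖g w‖) ^ 2 - 2 * ((a * p) * (q * ‖g w‖)) := by
        field_simp; ring
      linarith
    linarith
  rw [integral_add (hk.const_mul t) (hw.const_mul t⁻¹), integral_const_mul,
    integral_const_mul] at hle
  have h8 : t * ∫ w, k w ≤ t * ∫ u, ‖fourierHat f u‖ ^ 2 ∂waveSpectrum :=
    mul_le_mul_of_nonneg_left (integral_sq_hat_scaled f) ht.le
  have h9 : t⁻¹ * ∫ w, D w ≤ t⁻¹ * ((∫ w, D w) + 1) :=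
    mul_le_mul_of_nonneg_left (by linarith) (by positivity)
  linarith

lemma not_linearlyMaximallyRigid_randomWave {A : Set (E 2)} (hA : (interior A).Nonempty) :
    ¬ (randomWave waveSpectrum map_neg_waveSpectrum).LinearlyMaximallyRigid A := by
  obtain ⟨x, hx⟩ := hA
  obtain ⟨r, hr, hball⟩ := Metric.nhds_basis_closedBall.mem_iff.1 (mem_interior_iff_mem_nhds.1 hx)
  let b : ContDiffBump x := ⟨r / 2, r, half_pos hr, half_lt_self hr⟩
  intro hrig
  obtain ⟨C, hC, hbound⟩ := sq_integral_le b
  set J := ∫ y, bumpDeriv b y ^ 2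
  have hJ : 0 < J := integral_sq_bumpDeriv_pos b
  -- `J² / C` is the Cauchy–Schwarz lower bound for the variance; below, `t = C / J` optimizes the
  -- inequality to `J ≤ (C / J) · Var`.
  obtain ⟨h, hh, hvar⟩ := hrig _ (isTest_bumpDeriv b) (J ^ 2 / C) (by positivity)
  have hf := (isTest_bumpDeriv b).sub hh.1
  rw [StationaryRandomMeasure.variance_sub _ (isTest_bumpDeriv b) hh.1,
    variance_randomWave map_neg_waveSpectrum hf] at hvar
  have hint : ∫ y, (bumpDeriv b y - h y) * bumpDeriv b y = J := by
    refine integral_congr_ae (.of_forall fun y => ?_)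
    by_cases hy : bumpDeriv b y = 0
    · simp [hy]
    · have hyA : y ∈ A := hball (support_bumpDeriv_subset b hy)
      have : h y = 0 := by
        by_contra hne
        exact hh.2 hne hyA
      simp only [this, sub_zero, sq]
  have key := hbound _ hf (C / J) (by positivity)
  rw [hint, abs_of_pos hJ, inv_div, div_mul_cancel₀ _ hC.ne'] at key
  have h1 : C / J * (∫ u, ‖fourierHat (fun y => bumpDeriv b y - h y) u‖ ^ 2 ∂waveSpectrum) < J := by
    calc _ < C / J * (J ^ 2 / C) := mul_lt_mul_of_pos_left hvar (by positivity)
      _ = J := by field_simp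
  linarith

end NonRigid
end SpectralRigidity
end

theorem proposition3p8 :
    (∀ (Ω : Type*) [MeasurableSpace Ω] (P : Measure Ω) [IsProbabilityMeasure P]
        (M : SpectralRigidity.StationaryRandomMeasure 2 P)
        (S : Measure (SpectralRigidity.E 2)) (s : SpectralRigidity.E 2 → ℝ),
        M.IsSpectralMeasure S → SpectralRigidity.IsSpectralDensity S s →
        (∀ᶠ u in 𝓝 (!₂[1, 0] : SpectralRigidity.E 2), s u = u 1 ^ 2) →
        ∀ A : Set (SpectralRigidity.E 2), MeasurableSet A → Bornology.IsBounded A →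
          M.MassRigid A ∧
          M.LinearlyRigid A (A.indicator fun _ => 1) ∧
          ((∃ l : ℝ, M.HasMeanIntensity l) → M.IsLinearLimit A (A.indicator fun _ => 1))) ∧
    (∃ (Ω : Type) (_ : MeasurableSpace Ω) (P : Measure Ω) (_ : IsProbabilityMeasure P)
        (M : SpectralRigidity.StationaryRandomMeasure 2 P)
        (S : Measure (SpectralRigidity.E 2)) (s : SpectralRigidity.E 2 → ℝ),
        M.HasMeanIntensity 1 ∧ M.IsSpectralMeasure S ∧ SpectralRigidity.IsSpectralDensity S s ∧
        (∀ᶠ u in 𝓝 (!₂[1, 0] : SpectralRigidity.E 2), s u = u 1 ^ 2) ∧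
        (∀ᶠ u in 𝓝 (0 : SpectralRigidity.E 2), s u = 1) ∧
        ∀ A : Set (SpectralRigidity.E 2), MeasurableSet A → Bornology.IsBounded A →
          (interior A).Nonempty → ¬ M.LinearlyMaximallyRigid A) := by
  open SpectralRigidity in
  refine ⟨fun Ω _ P _ M S s hS hs hline A hA hAb => ?_, ?_⟩
  · have hr := linearlyRigid_of_zero_line hS hs hline hA hAb
    exact ⟨hr.massRigid hA hAb, hr, fun ⟨_, hl⟩ =>
      isLinearLimit_of_zero_line hS hs hline hl hA hAb⟩
  · exact ⟨E 2 × Bool, inferInstance, (normalized waveSpectrum).prod coin, inferInstance,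
      randomWave waveSpectrum map_neg_waveSpectrum, waveSpectrum, waveDensity,
      hasMeanIntensity_randomWave _, isSpectralMeasure_randomWave _,
      isSpectralDensity_waveSpectrum, waveDensity_near_one, waveDensity_near_zero,
      fun A _ _ hA => not_linearlyMaximallyRigid_randomWave hA⟩
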